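/- \textbf{Conventions.} Let $P$ be a finite poset with $\hat 0$ and $\hat 1$. An edge labelling $\lambda$ assigns elements of a totally ordered set to the covering relations $u\prec v$; the covering relations $u\prec\hat 1$ may be all labelled or all left without a label. We assume $\lambda(u,v)\neq\lambda(u,w)$ for distinct covers $v\ne w$ of $u$. Label sequences are compared lexicographically. The labelling is \emph{least-content-increasing} if on every interval the lexicographically smallest saturated chain is weakly increasing and its label sequence is lexicographically at most the increasing rearrangement of every label sequence on the interval. The cells of the order complex $\Delta(P)$ are the chains in $P\setminus\{\hat0,\hat1\}$ (including $\emptyset$), and its facets correspond to the saturated chains $F$ from $\hat0$ to $\hat1$, ordered lexicographically by label sequence. The \emph{minimal skipped intervals} of $F$ are the complements in $F$ of the maximal faces of the intersection of $F$ with the union of the earlier facets. Ordering them by lowest element, truncate as follows: keep the first one, remove its elements from all the others, discard those that now strictly contain others, and repeat. The \emph{lexicographic discrete Morse function} $M$ matches the faces $A$ of $F$ lying in no earlier facet by inserting or deleting one element of $F$. If some elements of $F$ lie in no minimal skipped interval, it is the lowest of them. Otherwise it is the lowest element of the first truncated interval $J$ for which $A\cap J$ does not consist of the lowest element of $J$ alone;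 if there is no such $J$, it is the lowest element of $F$ outside all truncated intervals, and $A$ is left unmatched if there is none. Unmatched cells are \emph{critical}; $F$ \emph{contributes} a critical cell $A$ if $A\subseteq F$ lies in no earlier facet. A \emph{gradient path} from $\tau$ to $\sigma$ is a sequence of cells that begins and ends with a downward step, in which downward steps (along covering relations of the face poset that are not matching edges) alternate with upward steps along matching edges. The \emph{multi-graph face poset} $P^M$ has the critical cells as vertices, and one edge from $\tau$ down to $\sigma$ for each gradient path from $\tau$ to $\sigma$ (so $\dim\tau=\dim\sigma+1$). \textbf{Lemma.} Let $\lambda$ be a least-content-increasing labelling of $P$ as above, and suppose that for each $x\ne\hat1$ the restriction of $\lambda$ to the interval from $\hat0$ to $x$ is a CL-labelling (every subinterval has exactly one weakly increasing saturated chain, and it lexicographically precedes all others). Let $N$ be a saturated chain from $\hat 0$ to $\hat 1$ contributing a critical cell, let $a$ be the minimal label on $N$, and let $S$ be the set of the labels on $N$ other than $a$. Let $T\subseteq S$ be such that for every $U\subseteq T$ there is a saturated chain from $\hat 0$ to $\hat 1$ with label sequence $(U^C)^{rev}\,a\,U$, i.e. the elements of $S\setminus U$ in decreasing order, then $a$,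 then the elements of $U$ in increasing order, which contributes a critical cell $Crit(U)$. Suppose that there is a gradient path from $Crit(U)$ to $Crit(U\cup\{i\})$ for all $U\subseteq T$ and $i\in T\setminus U$. Then the critical cells indexed by the subsets of $T$ sit inside $P^M$ as a Boolean algebra: the cells $Crit(U)$, $U\subseteq T$, are pairwise distinct, and for $U,W\subseteq T$ there is exactly one edge of $P^M$ from $Crit(U)$ down to $Crit(W)$ if $W=U\cup\{i\}$ for some $i\notin U$, and no such edge otherwise. -/

import Mathlib

/-! Lexicographic discrete Morse functions on order complexes of finite bounded posets. -/

namespace LexMorse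

/-! ### Discrete Morse theory of a family of finite cells

A matching of the face poset is given by a relation `m`, where `m ρ τ` means that `ρ` is matched
with the larger cell `τ`. -/

section Morse

variable {V : Type*}

/-- A critical cell: a cell that is left unmatched. -/
def IsCritical (cell : Finset V → Prop) (m : Finset V → Finset V → Prop) (A : Finset V) : Prop :=
  cell A ∧ ∀ B, ¬ m A B ∧ ¬ m B A

/-- A gradient path from `τ` to `σ`, recorded as the list of all its cells: downward steps along
covering relations of the face poset that do not belong to the matching alternate with upward
steps along the matching, and the path begins and ends with a downward step. -/
inductive IsGradientPath (m : Finset V → Finset V → Prop) :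
    Finset V → Finset V → List (Finset V) → Prop
  | last {τ σ : Finset V} : σ ⋖ τ → ¬ m σ τ → IsGradientPath m τ σ [τ, σ]
  | step {τ ρ τ' σ : Finset V} {l : List (Finset V)} : ρ ⋖ τ → ¬ m ρ τ → m ρ τ' →
      IsGradientPath m τ' σ l → IsGradientPath m τ σ (τ :: ρ :: l)

/-- The multi-graph face poset `P^M`: its vertices are the critical cells, and its edges from `τ`
down to `σ` are the gradient paths `l` from `τ` to `σ`. -/
def IsEdgePM (cell : Finset V → Prop) (m : Finset V → Finset V → Prop) (τ σ : Finset V)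
    (l : List (Finset V)) : Prop :=
  IsCritical cell m τ ∧ IsCritical cell m σ ∧ IsGradientPath m τ σ l

/-- The vertices `C U`, `U ⊆ T`, of `P^M` are distinct critical cells and the sub-multigraph of
`P^M` that they induce is the Hasse diagram of the Boolean algebra of subsets of `T` (with the
order reversed: `C V` lies below `C U` when `U ⊆ V`): one edge from `C U` down to `C V` if `V`
covers `U`, and no edge otherwise. -/
def SitsAsBooleanAlgebra {L : Type*} (cell : Finset V → Prop) (m : Finset V → Finset V → Prop)
    (T : Finset L) (C : Finset L → Finset V) : Prop :=
  (∀ U ⊆ T, IsCritical cell m (C U)) ∧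
  (∀ U ⊆ T, ∀ W ⊆ T, C U = C W → U = W) ∧
  (∀ U ⊆ T, ∀ W ⊆ T, U ⋖ W → ∃! l, IsEdgePM cell m (C U) (C W) l) ∧
  (∀ U ⊆ T, ∀ W ⊆ T, ¬ U ⋖ W → ¬ ∃ l, IsEdgePM cell m (C U) (C W) l)

end Morse

/-! ### Saturated chains and labellings -/

section Labelling

variable {P : Type*} [PartialOrder P] {L : Type*}

/-- `c` lists the elements of a saturated chain from `u` to `v`, in increasing order. -/
def IsSatChain (u v : P) (c : List P) : Prop :=
  c.IsChain (· ⋖ ·) ∧ c.head? = some u ∧ c.getLast? = some v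

/-- The sequence of labels on a saturated chain (covering relations without label are skipped). -/
def labelSeq (lab : P → P → Option L) : List P → List L
  | x :: y :: c => (lab x y).toList ++ labelSeq lab (y :: c)
  | _ => []

/-- An edge labelling of a poset with `0̂` and `1̂` that can be used for a lexicographic order on
the saturated chains: the covering relations `x ⋖ y` with `y ≠ 1̂` are labelled, those with
`y = 1̂` are either all labelled or all left without label, and distinct covering relations
upwards from the same element have distinct labels. -/
def IsEdgeLabelling [BoundedOrder P] (lab : P → P → Option L) : Prop :=
  (∀ x y : P, x ⋖ y → y ≠ ⊤ → (lab x y).isSome) ∧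
  ((∀ x : P, x ⋖ ⊤ → (lab x ⊤).isSome) ∨ (∀ x : P, x ⋖ ⊤ → lab x ⊤ = none)) ∧
  (∀ x y z : P, x ⋖ y → x ⋖ z → y ≠ z → lab x y ≠ lab x z)

variable [LinearOrder L]

/-- `c` is the lexicographically smallest saturated chain from `u` to `v`. -/
def IsLexSmallest (lab : P → P → Option L) (u v : P) (c : List P) : Prop :=
  IsSatChain u v c ∧ ∀ c', IsSatChain u v c' → labelSeq lab c ≤ labelSeq lab c'

/-- Every interval has a weakly increasing chain as its lexicographically smallest saturated
chain. -/
def IsLeastIncreasing (lab : P → P → Option L) : Prop :=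
  ∀ u v : P, u ≤ v → ∃ c, IsLexSmallest lab u v c ∧ (labelSeq lab c).Pairwise (· ≤ ·)

/-- In addition, the lexicographically smallest chain of an interval is at least as small as the
increasing rearrangement of every label sequence on the interval. -/
def IsLeastContentIncreasing (lab : P → P → Option L) : Prop :=
  IsLeastIncreasing lab ∧
  ∀ (u v : P) (c c' : List P), IsLexSmallest lab u v c → IsSatChain u v c' →
    labelSeq lab c ≤ (labelSeq lab c').mergeSort (fun x y => decide (x ≤ y))

/-- The restriction of the edge labelling to the interval from `0̂` to `x` is a CL-labelling
(for an edge labelling: an EL-labelling): each interval in it has exactly one weakly increasing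
saturated chain, and this chain lexicographically precedes all other saturated chains of the
interval. -/
def IsCLLabellingBelow (lab : P → P → Option L) (x : P) : Prop :=
  ∀ u v : P, u ≤ v → v ≤ x → ∃ c, IsSatChain u v c ∧ (labelSeq lab c).Pairwise (· ≤ ·) ∧
    ∀ c', IsSatChain u v c' → c' ≠ c →
      ¬ (labelSeq lab c').Pairwise (· ≤ ·) ∧ labelSeq lab c < labelSeq lab c'

end Labelling

/-! ### The lexicographic discrete Morse function on the order complex -/

section LexMatching

variable {P : Type*} [PartialOrder P] [BoundedOrder P]

/-- The cells of the order complex: chains of elements strictly between `0̂` and `1̂`, the empty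
chain included. -/
def IsCell (A : Finset P) : Prop :=
  (∀ x ∈ A, x ≠ ⊥ ∧ x ≠ ⊤) ∧ IsChain (· ≤ ·) (A : Set P)

variable [DecidableEq P] {L : Type*} [LinearOrder L]

/-- The facet of the order complex that is given by a saturated chain from `0̂` to `1̂`. -/
def facet (F : List P) : Finset P := F.toFinset \ {⊥, ⊤}

/-- `A` is a face of (the facet of) `F` but of no lexicographically earlier facet. -/
def IsNewFace (lab : P → P → Option L) (F : List P) (A : Finset P) : Prop :=
  IsSatChain ⊥ ⊤ F ∧ A ⊆ facet F ∧
  ∀ F', IsSatChain ⊥ ⊤ F' → labelSeq lab F' < labelSeq lab F → ¬ A ⊆ facet F'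

/-- The face that `F` retains when the set `K` of its elements is skipped lies in an earlier
facet. -/
def IsSkipped (lab : P → P → Option L) (F : List P) (K : Finset P) : Prop :=
  K ⊆ facet F ∧
  ∃ F', IsSatChain ⊥ ⊤ F' ∧ labelSeq lab F' < labelSeq lab F ∧ facet F \ K ⊆ facet F'

/-- The interval system of `F`: its minimal skipped intervals, i.e. the complements in `F` of the
maximal faces of the intersection of `F` with the union of the earlier facets. -/
def intervalSystem (lab : P → P → Option L) (F : List P) : Set (Finset P) :=
  {K | Minimal (IsSkipped lab F) K}

/-- One truncation step: discard `I`, chop off from the other intervals what they share with `I`,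
and discard intervals that now strictly contain other ones. -/
def truncate (𝓘 : Set (Finset P)) (I : Finset P) : Set (Finset P) :=
  {K | Minimal (fun K => ∃ I' ∈ 𝓘, I' ≠ I ∧ K = I' \ I) K}

/-- The truncation procedure turns the interval system `𝓘` into the list `𝓙` of disjoint
intervals: the interval with the lowest element is put into the list, and the procedure is
iterated with the truncated remaining intervals until there is none left. -/
inductive TruncatesTo : Set (Finset P) → List (Finset P) → Prop
  | nil : TruncatesTo ∅ []
  | cons {𝓘 : Set (Finset P)} {I : Finset P} {𝓙 : List (Finset P)} : I ∈ 𝓘 →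
      (∃ x ∈ I, ∀ K ∈ 𝓘, ∀ y ∈ K, x ≤ y) → TruncatesTo (truncate 𝓘 I) 𝓙 →
      TruncatesTo 𝓘 (I :: 𝓙)

/-- `v` is the element of `F` whose insertion or deletion matches the new face `A` of `F`.
If some elements of `F` lie in no minimal skipped interval (cone points), `v` is the lowest of
them. Otherwise `v` is the lowest element of the lowest truncated interval whose intersection
with `A` is not just its lowest element; if there is no such interval, `v` is the lowest element
of `F` outside the truncated intervals (and `A` is not matched if there is none). -/
def IsPivot (lab : P → P → Option L) (F : List P) (A : Finset P) (v : P) : Prop :=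
  IsLeast {x | x ∈ facet F ∧ ∀ K ∈ intervalSystem lab F, x ∉ K} v ∨
  ((∀ x ∈ facet F, ∃ K ∈ intervalSystem lab F, x ∈ K) ∧
    ∃ 𝓙 : List (Finset P), TruncatesTo (intervalSystem lab F) 𝓙 ∧
      ((∃ (𝓙₁ : List (Finset P)) (J : Finset P) (𝓙₂ : List (Finset P)), 𝓙 = 𝓙₁ ++ J :: 𝓙₂ ∧
          (∀ K : Finset P, K ∈ 𝓙₁ → ∃ x, IsLeast (K : Set P) x ∧ A ∩ K = {x}) ∧
          IsLeast (J : Set P) v ∧ A ∩ J ≠ {v}) ∨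
        ((∀ K : Finset P, K ∈ 𝓙 → ∃ x, IsLeast (K : Set P) x ∧ A ∩ K = {x}) ∧
          IsLeast {x | x ∈ facet F ∧ ∀ K ∈ 𝓙, x ∉ K} v)))

/-- The matching of the lexicographic discrete Morse function: `A` is matched with the larger
cell `B`. -/
def lexMatching (lab : P → P → Option L) (A B : Finset P) : Prop :=
  ∃ F v, IsNewFace lab F A ∧ IsPivot lab F A v ∧ v ∉ A ∧ B = insert v A

/-- The saturated chain `F` contributes the critical cell `A`. -/
def Contributes (lab : P → P → Option L) (F : List P) (A : Finset P) : Prop :=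
  IsNewFace lab F A ∧ IsCritical IsCell (lexMatching lab) A

end LexMatching

end LexMorse

namespace LexMorse

/-! Facets are simple because the labelling is CL below `⊤`. A skipped interval that ends below `⊤`
contains a descent of the facet, and the element at a descent is skipped on its own. So a minimal
skipped interval is a single element or a final segment of the facet (`intervalSystem_cases`). Such
intervals are disjoint, truncation changes nothing, and a critical cell consists of the elements
skipped on their own and the lowest other element, if there is one (`Contributes.mem_iff`). For the
label sequence (U^C)^rev a U this is the bottom segment x_1 < ... < x_{m+1} along which the labels
decrease down to `a`, where m = |S \ U| (`Contributes.exists_initialData`). This needs x_{m+1} ≠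
`⊤`. It holds because covers of `⊤` are unlabelled as soon as T is nonempty: otherwise the dimension
drop from Crit(∅) to Crit({i}) would be impossible.

On a gradient path from such a cell, deleting q_{l+1} forces the matching to insert the first
element of the least chain from q_l to q_{l+2} (`IsPivoted.step`). A path is thus encoded by the
positions l of its moves (`IsGradientPath.exists_movePath`). The quantity to follow is `stepKey q
l`, the first label of the least chain from q_l to q_{l+1}. Below `⊤`, the least-content condition
makes that first label a lower bound for all labels in the interval. A move at l therefore pulls
`stepKey` at l down to at most its old values at l and l + 1, and leaves a weak ascent there. The
target chain z has decreasing labels, which gives two constraints: its k-th label is at most the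
(k+1)-st step label if position k is ever moved (`MovePath.target_le_succ`), and the chain already
agrees with z up to k + 1 if k is never moved (`MovePath.eq_target_of_notMem`).

Uniqueness: for W = U ∪ {i}, the labels of z are those of x with the entry at some j omitted. The
inequalities then become equalities, and the moves must be j, j + 1, ... in this order
(`MovePath.eq_range`). Existence is assumed.

Absence of other edges: for a path from Crit(U) to Crit(W), the constraints compare the decreasing
lists of S \ U and S \ W entrywise. The last element of x never moves (`MovePath.run_last`), so a
chain from the top of z to `⊤` carries all labels of U. Its increasing rearrangement is
lexicographically at least W. Together these force U ⊆ W (`subset_of_sort_le`), and the dimension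
drop makes it a covering. -/

/-- The label of a covering relation, as an element of a linear order. -/
def key {P L : Type*} (lab : P → P → Option L) (u y : P) : WithBot L := lab u y

theorem key_eq_coe {P L : Type*} {lab : P → P → Option L} {u y : P} {b : L} :
    key lab u y = (b : WithBot L) ↔ lab u y = some b := Iff.rfl

/-! ### Saturated chains -/

section SatChain

variable {P : Type*} [PartialOrder P]

/-- Inductive form of `IsSatChain`. -/
inductive SatC : P → P → List P → Prop
  | single (u : P) : SatC u u [u]
  | cons {u y v : P} {c : List P} : u ⋖ y → SatC y v c → SatC u v (u :: c)

theorem SatC.exists_eq_cons {u v : P} {c : List P} (h : SatC u v c) : ∃ r, c = u :: r := by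
  cases h <;> exact ⟨_, rfl⟩

theorem isSatChain_iff {u v : P} {c : List P} : IsSatChain u v c ↔ SatC u v c := by
  constructor
  · rintro ⟨h1, h2, h3⟩
    induction c generalizing u with
    | nil => simp at h2
    | cons x c ih =>
      obtain rfl : x = u := by simpa using h2
      cases c with
      | nil =>
        obtain rfl : x = v := by simpa using h3
        exact .single x
      | cons y c =>
        rw [List.isChain_cons_cons] at h1
        exact .cons h1.1 (ih h1.2 rfl (by simpa [List.getLast?_cons_cons] using h3))
  · intro h
    induction h with
    | single u => exact ⟨by simp, by simp, by simp⟩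
    | @cons u y v c h1 h2 ih =>
      obtain ⟨r, rfl⟩ := h2.exists_eq_cons
      exact ⟨List.isChain_cons_cons.2 ⟨h1, ih.1⟩, rfl,
        by simpa [List.getLast?_cons_cons] using ih.2.2⟩

theorem SatC.left_mem {u v : P} {c : List P} (h : SatC u v c) : u ∈ c := by
  obtain ⟨r, rfl⟩ := h.exists_eq_cons; simp

theorem SatC.right_mem {u v : P} {c : List P} (h : SatC u v c) : v ∈ c := by
  induction h with
  | single => simp
  | cons _ _ ih => simp [ih]

theorem SatC.le {u v : P} {c : List P} (h : SatC u v c) : u ≤ v := by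
  induction h with
  | single => rfl
  | cons h1 _ ih => exact h1.le.trans ih

theorem SatC.mem_bounds {u v : P} {c : List P} (h : SatC u v c) {t : P} (ht : t ∈ c) :
    u ≤ t ∧ t ≤ v := by
  induction h with
  | single => simp_all
  | cons h1 h2 ih =>
    rcases List.mem_cons.1 ht with rfl | ht
    · exact ⟨le_rfl, h1.le.trans h2.le⟩
    · exact ⟨h1.le.trans (ih ht).1, (ih ht).2⟩

theorem SatC.total {u v : P} {c : List P} (h : SatC u v c) {s t : P} (hs : s ∈ c) (ht : t ∈ c) :
    s ≤ t ∨ t ≤ s := by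
  induction h with
  | single => simp_all
  | cons h1 h2 ih =>
    rcases List.mem_cons.1 ht with ht' | ht' <;> rcases List.mem_cons.1 hs with hs' | hs'
    · exact .inl (hs'.trans ht'.symm).le
    · exact .inr (ht' ▸ h1.le.trans (h2.mem_bounds hs').1)
    · exact .inl (hs' ▸ h1.le.trans (h2.mem_bounds ht').1)
    · exact ih hs' ht'

theorem SatC.lt_or_le {u v : P} {c : List P} (h : SatC u v c) {s t : P} (hs : s ∈ c) (ht : t ∈ c) :
    s < t ∨ t ≤ s := by
  rcases h.total hs ht with h1 | h1
  · rcases h1.eq_or_lt with rfl | h1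
    · exact .inr le_rfl
    · exact .inl h1
  · exact .inr h1

theorem SatC.exists_next {u v : P} {c : List P} (h : SatC u v c) {t : P} (ht : t ∈ c)
    (hv : t ≠ v) : ∃ y ∈ c, t ⋖ y := by
  induction h with
  | single => simp_all
  | cons h1 h2 ih =>
    rcases List.mem_cons.1 ht with rfl | ht
    · exact ⟨_, by simp [h2.left_mem], h1⟩
    · obtain ⟨y, hy, hty⟩ := ih ht hv
      exact ⟨y, by simp [hy], hty⟩

theorem SatC.exists_prev {u v : P} {c : List P} (h : SatC u v c) {t : P} (ht : t ∈ c)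
    (hv : t ≠ u) : ∃ y ∈ c, y ⋖ t := by
  induction h with
  | single => simp_all
  | @cons u y v c h1 h2 ih =>
    rcases List.mem_cons.1 ht with rfl | ht
    · exact absurd rfl hv
    · by_cases hty : t = y
      · subst hty; exact ⟨u, by simp, h1⟩
      · obtain ⟨y, hy, hty⟩ := ih ht hty
        exact ⟨y, by simp [hy], hty⟩

/-- Elements of a saturated chain above `x` are above the next element. -/
theorem SatC.ge_of_covBy {u v : P} {c : List P} (h : SatC u v c) {x y t : P}
    (hy : y ∈ c) (hxy : x ⋖ y) (ht : t ∈ c) (hxt : x < t) : y ≤ t := by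
  rcases h.lt_or_le ht hy with h1 | h1
  · exact absurd h1 (hxy.2 hxt)
  · exact h1

theorem SatC.le_of_covBy {u v : P} {c : List P} (h : SatC u v c) {x y t : P}
    (hx : x ∈ c) (hxy : x ⋖ y) (ht : t ∈ c) (hxt : t < y) : t ≤ x := by
  rcases h.lt_or_le hx ht with h1 | h1
  · exact absurd hxt (hxy.2 h1)
  · exact h1

theorem SatC.unique_next {u v : P} {c : List P} (h : SatC u v c) {x y z : P}
    (hy : y ∈ c) (hz : z ∈ c) (hxy : x ⋖ y) (hxz : x ⋖ z) : y = z :=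
  le_antisymm (h.ge_of_covBy hy hxy hz hxz.lt) (h.ge_of_covBy hz hxz hy hxy.lt)

theorem SatC.eq_of_le {u v : P} {c c' : List P} (h : SatC u v c) (h' : SatC u v c')
    (hsub : ∀ t ∈ c, t ∈ c') : c = c' := by
  induction h generalizing c' with
  | single u =>
    cases h' with
    | single => rfl
    | cons h1 h2 => exact absurd h2.le h1.lt.not_ge
  | @cons u y v c h1 h2 ih =>
    cases h' with
    | single => exact absurd h2.le h1.lt.not_ge
    | @cons _ y' _ c' h1' h2' =>
      have hh : SatC u v (u :: c') := .cons h1' h2'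
      have : y = y' := hh.unique_next (hsub y (by simp [h2.left_mem])) (by simp [h2'.left_mem])
        h1 h1'
      subst this
      rw [ih h2']
      intro t ht
      rcases List.mem_cons.1 (hsub t (by simp [ht])) with rfl | h3
      · exact absurd (h2.mem_bounds ht).1 h1.lt.not_ge
      · exact h3

variable {L : Type*} (lab : P → P → Option L)

theorem SatC.labelSeq_cons {y v : P} {c : List P} (h : SatC y v c) (u : P) :
    labelSeq lab (u :: c) = (lab u y).toList ++ labelSeq lab c := by
  obtain ⟨r, rfl⟩ := h.exists_eq_cons; rfl

theorem SatC.glue {u x v : P} {c d : List P} (hc : SatC u x c) (hd : SatC x v d) :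
    ∃ e, SatC u v e ∧ labelSeq lab e = labelSeq lab c ++ labelSeq lab d ∧
      ∀ t, t ∈ e ↔ t ∈ c ∨ t ∈ d := by
  induction hc with
  | single u =>
    refine ⟨d, hd, by simp [labelSeq], fun t => ?_⟩
    constructor
    · exact .inr
    · rintro (h | h)
      · obtain rfl : t = u := by simpa using h
        exact hd.left_mem
      · exact h
  | @cons u y x c h1 h2 ih =>
    obtain ⟨e, he, hl, hm⟩ := ih hd
    refine ⟨u :: e, .cons h1 he, ?_, fun t => ?_⟩
    · rw [he.labelSeq_cons, h2.labelSeq_cons, hl, List.append_assoc]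
    · simp [hm, or_assoc]

theorem SatC.split {u v : P} {c : List P} (h : SatC u v c) {x : P} (hx : x ∈ c) :
    ∃ d e, SatC u x d ∧ SatC x v e ∧ labelSeq lab c = labelSeq lab d ++ labelSeq lab e ∧
      (∀ t, t ∈ d ↔ t ∈ c ∧ t ≤ x) ∧ (∀ t, t ∈ e ↔ t ∈ c ∧ x ≤ t) := by
  induction h with
  | single u =>
    obtain rfl : x = u := by simpa using hx
    refine ⟨[x], [x], .single x, .single x, by simp [labelSeq], fun t => ?_, fun t => ?_⟩ <;>
      simp +contextual
  | @cons u y v c h1 h2 ih =>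
    by_cases hxu : x = u
    · subst hxu
      have hc := SatC.cons h1 h2
      refine ⟨[x], x :: c, .single x, hc, by simp [labelSeq], fun t => ?_, fun t => ?_⟩
      · constructor
        · intro h
          obtain rfl : t = x := by simpa using h
          exact ⟨by simp, le_rfl⟩
        · rintro ⟨h, h'⟩
          simp [le_antisymm h' (hc.mem_bounds h).1]
      · exact ⟨fun h => ⟨h, (hc.mem_bounds h).1⟩, fun h => h.1⟩
    · obtain ⟨d, e, hd, he, hl, hdm, hem⟩ := ih ((List.mem_cons.1 hx).resolve_left hxu)
      refine ⟨u :: d, e, .cons h1 hd, he, ?_, fun t => ?_, fun t => ?_⟩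
      · rw [h2.labelSeq_cons, hd.labelSeq_cons, hl, List.append_assoc]
      · simp only [List.mem_cons, hdm]
        constructor
        · rintro (rfl | h)
          · exact ⟨.inl rfl, h1.le.trans hd.le⟩
          · exact ⟨.inr h.1, h.2⟩
        · rintro ⟨rfl | h, h'⟩
          · exact .inl rfl
          · exact .inr ⟨h, h'⟩
      · rw [hem, List.mem_cons]
        constructor
        · exact fun h => ⟨.inr h.1, h.2⟩
        · rintro ⟨rfl | h, h'⟩
          · exact absurd (hd.le.trans h') h1.lt.not_ge
          · exact ⟨h, h'⟩

variable {lab}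

theorem SatC.exists_diverge {u v : P} {c c' : List P} (h : SatC u v c) (h' : SatC u v c')
    (hne : c ≠ c') : ∃ x y z, x ∈ c ∧ x ∈ c' ∧ y ∈ c ∧ z ∈ c' ∧ x ⋖ y ∧ x ⋖ z ∧ y ≠ z ∧
      ∀ t ≤ x, t ∈ c ↔ t ∈ c' := by
  induction h generalizing c' with
  | single u =>
    cases h' with
    | single => exact absurd rfl hne
    | cons h1 h2 => exact absurd h2.le h1.lt.not_ge
  | @cons u y v c h1 h2 ih =>
    cases h' with
    | single => exact absurd h2.le h1.lt.not_ge
    | @cons _ y' _ c' h1' h2' =>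
      by_cases hy : y = y'
      · subst hy
        obtain ⟨x, p, q, hx, hx', hp, hq, hxp, hxq, hpq, hag⟩ := ih h2' (by rintro rfl; simp at hne)
        refine ⟨x, p, q, by simp [hx], by simp [hx'], by simp [hp], by simp [hq], hxp, hxq, hpq,
          fun t ht => ?_⟩
        simp [hag t ht]
      · refine ⟨u, y, y', by simp, by simp, by simp [h2.left_mem], by simp [h2'.left_mem], h1, h1',
          hy, fun t ht => ?_⟩
        constructor
        · intro h
          simp [le_antisymm ht ((SatC.cons h1 h2).mem_bounds h).1]
        · intro h
          simp [le_antisymm ht ((SatC.cons h1' h2').mem_bounds h).1]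

theorem SatC.labelSeq_lt [LinearOrder L] {u v : P} {c c' : List P} (h : SatC u v c)
    (h' : SatC u v c') {x y z : P} (hx : x ∈ c) (hx' : x ∈ c') (hy : y ∈ c) (hz : z ∈ c')
    (hxy : x ⋖ y) (hxz : x ⋖ z) (hag : ∀ t ≤ x, t ∈ c ↔ t ∈ c') {a b : L}
    (ha : lab x y = some a) (hb : lab x z = some b) (hab : a < b) :
    labelSeq lab c < labelSeq lab c' := by
  induction h generalizing c' with
  | single u =>
    obtain rfl : x = u := by simpa using hx
    obtain rfl : y = x := by simpa using hy
    exact absurd rfl hxy.lt.ne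
  | @cons u p v c h1 h2 ih =>
    have hc := SatC.cons h1 h2
    cases h' with
    | single => exact absurd h2.le h1.lt.not_ge
    | @cons _ p' _ c' h1' h2' =>
      have hc' := SatC.cons h1' h2'
      rw [h2.labelSeq_cons, h2'.labelSeq_cons]
      by_cases hxu : x = u
      · subst hxu
        obtain rfl := hc.unique_next hy (by simp [h2.left_mem]) hxy h1
        obtain rfl := hc'.unique_next hz (by simp [h2'.left_mem]) hxz h1'
        rw [ha, hb]
        simpa using List.cons_lt_cons_iff.2 (.inl hab)
      · have hxc : x ∈ c := (List.mem_cons.1 hx).resolve_left hxu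
        have hpx : p ≤ x := (h2.mem_bounds hxc).1
        have hp : p ∈ u :: c' := (hag p hpx).1 (by simp [h2.left_mem])
        obtain rfl := hc'.unique_next hp (by simp [h2'.left_mem]) h1 h1'
        apply List.append_left_lt
        have hux : u < x := h1.lt.trans_le hpx
        have aux : ∀ {t : P} {d : List P}, u < t → t ∈ u :: d → t ∈ d := fun h1 h2 =>
          (List.mem_cons.1 h2).resolve_left h1.ne'
        refine ih h2' hxc (aux hux hx') (aux (hux.trans hxy.lt) hy)
          (aux (hux.trans hxz.lt) hz) fun t ht => ?_
        constructor
        · intro h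
          exact aux (h1.lt.trans_le (h2.mem_bounds h).1) ((hag t ht).1 (by simp [h]))
        · intro h
          exact aux (h1.lt.trans_le (h2'.mem_bounds h).1) ((hag t ht).2 (by simp [h]))

end SatChain

/-! ### Labels and lexicographic order -/

section Labels

variable {P : Type*} [PartialOrder P] [BoundedOrder P] {L : Type*} {lab : P → P → Option L}

theorem IsEdgeLabelling.key_ne (hlab : IsEdgeLabelling lab) {x y z : P} (hy : x ⋖ y) (hz : x ⋖ z)
    (hne : y ≠ z) : key lab x y ≠ key lab x z := hlab.2.2 x y z hy hz hne

theorem IsEdgeLabelling.exists_label (hlab : IsEdgeLabelling lab) {x y : P} (hy : x ⋖ y)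
    (hne : y ≠ ⊤) : ∃ b, lab x y = some b := Option.isSome_iff_exists.1 (hlab.1 x y hy hne)

theorem ne_top_of_covBy {x y z : P} (hy : x ⋖ y) (hz : x ⋖ z) (hne : y ≠ z) : y ≠ ⊤ := by
  rintro rfl
  exact hy.2 hz.lt (lt_top_iff_ne_top.2 hne.symm)

variable [LinearOrder L]

theorem IsEdgeLabelling.labelSeq_lt_of_key (hlab : IsEdgeLabelling lab) {u v : P} {c c' : List P}
    (h : SatC u v c) (h' : SatC u v c') {x y z : P} (hx : x ∈ c) (hx' : x ∈ c') (hy : y ∈ c)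
    (hz : z ∈ c') (hxy : x ⋖ y) (hxz : x ⋖ z) (hag : ∀ t ≤ x, t ∈ c ↔ t ∈ c')
    (hk : key lab x y < key lab x z) : labelSeq lab c < labelSeq lab c' := by
  have hne : y ≠ z := by rintro rfl; exact lt_irrefl _ hk
  obtain ⟨a, ha⟩ := hlab.exists_label hxy (ne_top_of_covBy hxy hxz hne)
  obtain ⟨b, hb⟩ := hlab.exists_label hxz (ne_top_of_covBy hxz hxy hne.symm)
  rw [key_eq_coe.2 ha, key_eq_coe.2 hb, WithBot.coe_lt_coe] at hk
  exact h.labelSeq_lt h' hx hx' hy hz hxy hxz hag ha hb hk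

theorem IsEdgeLabelling.exists_key_lt (hlab : IsEdgeLabelling lab) {u v : P} {c c' : List P}
    (h : SatC u v c) (h' : SatC u v c') (hlt : labelSeq lab c < labelSeq lab c') :
    ∃ x y z, x ∈ c ∧ x ∈ c' ∧ y ∈ c ∧ z ∈ c' ∧ x ⋖ y ∧ x ⋖ z ∧
      (∀ t ≤ x, t ∈ c ↔ t ∈ c') ∧ key lab x y < key lab x z := by
  have hne : c ≠ c' := by rintro rfl; exact lt_irrefl _ hlt
  obtain ⟨x, y, z, hx, hx', hy, hz, hxy, hxz, hyz, hag⟩ := h.exists_diverge h' hne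
  refine ⟨x, y, z, hx, hx', hy, hz, hxy, hxz, hag, ?_⟩
  by_contra hk
  have hk := (not_lt.1 hk).lt_of_ne (hlab.key_ne hxz hxy hyz.symm)
  exact lt_asymm hlt
    (hlab.labelSeq_lt_of_key h' h hx' hx hz hy hxz hxy (fun t ht => (hag t ht).symm) hk)

omit [BoundedOrder P] in
theorem IsLeastContentIncreasing.exists_satC (hlci : IsLeastContentIncreasing lab) {u v : P}
    (h : u ≤ v) : ∃ c, SatC u v c := by
  obtain ⟨c, hc, -⟩ := hlci.1 u v h
  exact ⟨c, isSatChain_iff.1 hc.1⟩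

open Classical in
/-- The cover of `u` below `q` with the smallest label. -/
noncomputable def firstStep (lab : P → P → Option L) (u q : P) : P :=
  if h : ∃ y, u ⋖ y ∧ y ≤ q ∧ ∀ y', u ⋖ y' → y' ≤ q → key lab u y ≤ key lab u y' then h.choose
  else u

variable [Finite P]

omit [BoundedOrder P] in
theorem firstStep_spec (hlci : IsLeastContentIncreasing lab) {u q : P} (h : u < q) :
    u ⋖ firstStep lab u q ∧ firstStep lab u q ≤ q ∧
      ∀ y', u ⋖ y' → y' ≤ q → key lab u (firstStep lab u q) ≤ key lab u y' := by
  have : ∃ y, u ⋖ y ∧ y ≤ q ∧ ∀ y', u ⋖ y' → y' ≤ q → key lab u y ≤ key lab u y' := by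
    obtain ⟨c, hc⟩ := hlci.exists_satC h.le
    obtain ⟨y, hy, huy⟩ := hc.exists_next hc.left_mem h.ne
    obtain ⟨y, hy, hmin⟩ := Set.exists_min_image {y | u ⋖ y ∧ y ≤ q} (key lab u)
      (Set.toFinite _) ⟨y, huy, (hc.mem_bounds hy).2⟩
    exact ⟨y, hy.1, hy.2, fun y' h1 h2 => hmin y' ⟨h1, h2⟩⟩
  rw [firstStep, dif_pos this]
  exact this.choose_spec

omit [BoundedOrder P] in
theorem firstStep_eq_of_covBy (hlci : IsLeastContentIncreasing lab) {u q : P} (h : u ⋖ q) :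
    firstStep lab u q = q := by
  obtain ⟨h1, h2, -⟩ := firstStep_spec hlci h.lt
  exact h2.eq_or_lt.resolve_right (h.2 h1.lt)

/-- The comparison of contents enters here: a chain from `u` to `q` is routed through `x ⋖ y`, and
the least chain is compared with its sorted label sequence. Since `q ≠ ⊤`, every label involved
exists. -/
theorem key_firstStep_le (hlab : IsEdgeLabelling lab) (hlci : IsLeastContentIncreasing lab)
    {u q x y : P} (hq : q ≠ ⊤) (hux : u ≤ x) (hxy : x ⋖ y) (hyq : y ≤ q) :
    key lab u (firstStep lab u q) ≤ key lab x y := by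
  have huq : u < q := hux.trans_lt (hxy.lt.trans_le hyq)
  have ne_top : ∀ {t}, t ≤ q → t ≠ ⊤ := fun h => ne_top_of_le_ne_top hq h
  obtain ⟨b, hb⟩ := hlab.exists_label hxy (ne_top hyq)
  obtain ⟨d, hd⟩ := hlci.exists_satC hux
  obtain ⟨e, he⟩ := hlci.exists_satC hyq
  obtain ⟨c', hc', hl, -⟩ := hd.glue lab (SatC.cons hxy he)
  rw [he.labelSeq_cons, hb] at hl
  have hbm : b ∈ labelSeq lab c' := by simp [hl]
  obtain ⟨c, hc, -⟩ := hlci.1 u q huq.le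
  have hle := hlci.2 u q c c' hc (isSatChain_iff.2 hc')
  have hcs := isSatChain_iff.1 hc.1
  have hfirst := (firstStep_spec hlci huq).2.2
  cases hcs with
  | single => exact absurd huq (lt_irrefl _)
  | @cons _ p _ c h1 h2 =>
    refine (hfirst p h1 h2.le).trans ?_
    obtain ⟨g, hg⟩ := hlab.exists_label h1 (ne_top h2.le)
    rw [h2.labelSeq_cons, hg] at hle
    -- The label `b` occurs in the sorted sequence, so the first entry of that sequence is at most
    -- `b`; lexicographic comparison bounds `g` by this entry.
    have hpw : ((labelSeq lab c').mergeSort (fun x y => decide (x ≤ y))).Pairwise (· ≤ ·) := by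
      have := List.pairwise_mergeSort (le := fun x y : L => decide (x ≤ y))
        (by simpa using fun a b c => le_trans) (by simpa using le_total) (labelSeq lab c')
      simpa using this
    have hmem : b ∈ (labelSeq lab c').mergeSort (fun x y => decide (x ≤ y)) := by simpa using hbm
    generalize (labelSeq lab c').mergeSort (fun x y => decide (x ≤ y)) = s at hle hpw hmem
    rw [key_eq_coe.2 hg, key_eq_coe.2 hb, WithBot.coe_le_coe]
    cases s with
    | nil => simp at hmem
    | cons m s =>
      have hgm : g ≤ m := by
        by_contra hlt
        refine absurd hle (not_le.2 ?_)
        exact List.cons_lt_cons_iff.2 (.inl (not_le.1 hlt))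
      rcases List.mem_cons.1 hmem with rfl | h
      · exact hgm
      · exact hgm.trans (List.rel_of_pairwise_cons hpw h)

omit [Finite P] in
theorem SatC.isChain_labelSeq (hlab : IsEdgeLabelling lab) {u q : P} {c : List P} (h : SatC u q c)
    (hq : q ≠ ⊤)
    (hasc : ∀ x ∈ c, ∀ y ∈ c, ∀ t ∈ c, x ⋖ y → y ⋖ t → key lab x y ≤ key lab y t) :
    (labelSeq lab c).IsChain (· ≤ ·) := by
  induction h with
  | single u => simp [labelSeq]
  | @cons u y q c h1 h2 ih =>
    have ih := ih hq fun x hx y hy t ht => hasc x (by simp [hx]) y (by simp [hy]) t (by simp [ht])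
    obtain ⟨a, ha⟩ := hlab.exists_label h1 (ne_top_of_le_ne_top hq h2.le)
    rw [h2.labelSeq_cons, ha]
    cases h2 with
    | single => simp [labelSeq]
    | @cons _ z _ c h3 h4 =>
      obtain ⟨b, hb⟩ := hlab.exists_label h3 (ne_top_of_le_ne_top hq h4.le)
      rw [h4.labelSeq_cons, hb] at ih ⊢
      have := hasc u (by simp) y (by simp) z (by simp [h4.left_mem]) h1 h3
      rw [key_eq_coe.2 ha, key_eq_coe.2 hb, WithBot.coe_le_coe] at this
      exact List.isChain_cons_cons.2 ⟨this, ih⟩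

omit [Finite P] in
/-- A chain without descents in an interval below the top is lexicographically smallest. -/
theorem SatC.not_lt_of_ascending (hlab : IsEdgeLabelling lab)
    (hCL : ∀ x : P, x ≠ ⊤ → IsCLLabellingBelow lab x) {u q : P} {c c' : List P} (h : SatC u q c)
    (hq : q ≠ ⊤)
    (hasc : ∀ x ∈ c, ∀ y ∈ c, ∀ t ∈ c, x ⋖ y → y ⋖ t → key lab x y ≤ key lab y t)
    (h' : SatC u q c') : ¬ labelSeq lab c' < labelSeq lab c := by
  have hpw := List.isChain_iff_pairwise.1 (h.isChain_labelSeq hlab hq hasc)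
  obtain ⟨d, hd, -, hmin⟩ := hCL q hq u q h.le le_rfl
  have hcd : c = d := by
    by_contra hne
    exact (hmin c (isSatChain_iff.2 h) hne).1 hpw
  subst hcd
  by_cases hne : c' = c
  · subst hne; exact lt_irrefl _
  · exact (hmin c' (isSatChain_iff.2 h') hne).2.not_gt

end Labels

/-! ### Skipped intervals -/

section Skipped

variable {P : Type*} [PartialOrder P] [BoundedOrder P] [DecidableEq P] {L : Type*}

theorem mem_facet {F : List P} {x : P} : x ∈ facet F ↔ x ∈ F ∧ x ≠ ⊥ ∧ x ≠ ⊤ := by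
  simp [facet, not_or]

variable [LinearOrder L] {lab : P → P → Option L}

/-- Following `F` up to `x`, stepping to `z`, climbing to `q` and rejoining `F` gives an earlier
facet that loses only elements strictly between `x` and `q`. -/
theorem isSkipped_of_key_lt (hlab : IsEdgeLabelling lab) (hlci : IsLeastContentIncreasing lab)
    {F : List P} (hF : SatC ⊥ ⊤ F) {x y z q : P} (hx : x ∈ F) (hy : y ∈ F) (hq : q ∈ F)
    (hxy : x ⋖ y) (hxz : x ⋖ z) (hzq : z ≤ q) (hk : key lab x z < key lab x y) {K : Finset P}
    (hK : K ⊆ facet F) (hsub : ∀ t ∈ F, x < t → t < q → t ∈ K) : IsSkipped lab F K := by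
  obtain ⟨d, _, hd, _, _, hdm, _⟩ := hF.split lab hx
  obtain ⟨_, e, _, he, _, _, hem⟩ := hF.split lab hq
  obtain ⟨m, hm⟩ := hlci.exists_satC hzq
  obtain ⟨G₁, hG₁, -, hG₁m⟩ := hd.glue lab (SatC.cons hxz hm)
  obtain ⟨G, hG, -, hGm⟩ := hG₁.glue lab he
  have hmem : ∀ t, t ∈ G ↔ (t ∈ F ∧ t ≤ x) ∨ t ∈ m ∨ (t ∈ F ∧ q ≤ t) := by
    intro t
    rw [hGm, hG₁m, hdm, hem, List.mem_cons]
    constructor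
    · rintro ((h | rfl | h) | h)
      · exact .inl h
      · exact .inl ⟨hx, le_rfl⟩
      · exact .inr (.inl h)
      · exact .inr (.inr h)
    · rintro (h | h | h)
      · exact .inl (.inl h)
      · exact .inl (.inr (.inr h))
      · exact .inr h
  have hag : ∀ t ≤ x, t ∈ G ↔ t ∈ F := by
    intro t ht
    rw [hmem]
    refine ⟨?_, fun h => .inl ⟨h, ht⟩⟩
    rintro (h | h | h)
    · exact h.1
    · exact absurd ((hm.mem_bounds h).1.trans ht) hxz.lt.not_ge
    · exact h.1
  refine ⟨hK, G, isSatChain_iff.2 hG, ?_, ?_⟩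
  · exact hlab.labelSeq_lt_of_key hG hF ((hag x le_rfl).2 hx) hx
      ((hmem z).2 (.inr (.inl hm.left_mem))) hy hxz hxy hag hk
  · intro t ht
    rw [Finset.mem_sdiff, mem_facet] at ht
    refine mem_facet.2 ⟨(hmem t).2 ?_, ht.1.2⟩
    rcases hF.lt_or_le hx ht.1.1 with h1 | h1
    · rcases hF.lt_or_le ht.1.1 hq with h2 | h2
      · exact absurd (hsub t ht.1.1 h1 h2) ht.2
      · exact .inr (.inr ⟨ht.1.1, h2⟩)
    · exact .inl ⟨ht.1.1, h1⟩

variable [Finite P]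

theorem IsSkipped.exists_key_lt (hlab : IsEdgeLabelling lab) {F : List P} (hF : SatC ⊥ ⊤ F)
    {K : Finset P} (hK : IsSkipped lab F K) :
    ∃ x y z q, x ∈ F ∧ y ∈ F ∧ q ∈ F ∧ x ⋖ y ∧ x ⋖ z ∧ z ≤ q ∧ key lab x z < key lab x y ∧
      ∀ t ∈ F, x < t → t < q → t ∈ K := by
  obtain ⟨-, G, hG, hlt, hsub⟩ := hK
  rw [isSatChain_iff] at hG
  obtain ⟨x, z, y, hxG, hx, hz, hy, hxz, hxy, hag, hk⟩ := hlab.exists_key_lt hG hF hlt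
  -- The element `q` is where the earlier chain first meets `F` again after diverging at `x`;
  -- everything of `F` in between must have been skipped.
  obtain ⟨q, hq⟩ := Set.Finite.exists_minimal (s := {t | t ∈ F ∧ x < t ∧ t ∈ G}) (Set.toFinite _)
    ⟨⊤, hF.right_mem, hxy.lt.trans_le le_top, hG.right_mem⟩
  obtain ⟨⟨hqF, hxq, hqG⟩, hmin⟩ := hq
  refine ⟨x, y, z, q, hx, hy, hqF, hxy, hxz, hG.ge_of_covBy hz hxz hqG hxq, hk, ?_⟩
  intro t ht h1 h2
  by_contra htK
  have htf : t ∈ facet F := mem_facet.2 ⟨ht, (bot_le.trans_lt h1).ne', (h2.trans_le le_top).ne⟩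
  have htG := (mem_facet.1 (hsub (Finset.mem_sdiff.2 ⟨htf, htK⟩))).1
  exact h2.not_ge (hmin ⟨ht, h1, htG⟩ h2.le)

theorem not_isSkipped_empty (hlab : IsEdgeLabelling lab) {F : List P} (hF : SatC ⊥ ⊤ F) :
    ¬ IsSkipped lab F ∅ := by
  intro h
  obtain ⟨x, y, z, q, hx, hy, hq, hxy, hxz, hzq, hk, hsub⟩ := h.exists_key_lt hlab hF
  rcases (hF.ge_of_covBy hy hxy hq (hxz.lt.trans_le hzq)).eq_or_lt with rfl | h
  · rcases hzq.eq_or_lt with rfl | h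
    · exact lt_irrefl _ hk
    · exact hxy.2 hxz.lt h
  · simpa using hsub y hy hxy.lt h

/-- The criterion involves only the two neighbours of `y` in `F`. This locality allows skipped
singletons to be transferred between facets that agree near `y`. -/
theorem isSkipped_singleton_iff (hlab : IsEdgeLabelling lab)
    (hlci : IsLeastContentIncreasing lab) {F : List P} (hF : SatC ⊥ ⊤ F) {x y t : P} (hx : x ∈ F)
    (hy : y ∈ F) (ht : t ∈ F) (hxy : x ⋖ y) (hyt : y ⋖ t) :
    IsSkipped lab F {y} ↔ ∃ z, x ⋖ z ∧ z ≤ t ∧ key lab x z < key lab x y := by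
  have hyf : y ∈ facet F :=
    mem_facet.2 ⟨hy, (bot_le.trans_lt hxy.lt).ne', (hyt.lt.trans_le le_top).ne⟩
  constructor
  · intro h
    obtain ⟨x', y', z, q, hx', hy', hq, hxy', hxz, hzq, hk, hsub⟩ := h.exists_key_lt hlab hF
    have hyq : y' < q := by
      refine (hF.ge_of_covBy hy' hxy' hq (hxz.lt.trans_le hzq)).lt_of_ne ?_
      rintro rfl
      rcases hzq.eq_or_lt with rfl | h
      · exact lt_irrefl _ hk
      · exact hxy'.2 hxz.lt h
    obtain rfl : y' = y := by simpa using hsub y' hy' hxy'.lt hyq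
    obtain rfl : x' = x :=
      le_antisymm (hF.le_of_covBy hx hxy hx' hxy'.lt) (hF.le_of_covBy hx' hxy' hx hxy.lt)
    refine ⟨z, hxz, hzq.trans ?_, hk⟩
    rcases hF.lt_or_le ht hq with h | h
    · exact absurd (hsub t ht (hxy.lt.trans hyt.lt) h) (by simpa using hyt.lt.ne')
    · exact h
  · rintro ⟨z, hxz, hzt, hk⟩
    refine isSkipped_of_key_lt hlab hlci hF hx hy ht hxy hxz hzt hk (by simpa using hyf) ?_
    intro s hs h1 h2
    exact Finset.mem_singleton.2
      (le_antisymm (hF.le_of_covBy hy hyt hs h2) (hF.ge_of_covBy hy hxy hs h1))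

theorem isSkipped_of_descent (hlab : IsEdgeLabelling lab) (hlci : IsLeastContentIncreasing lab)
    {F : List P} (hF : SatC ⊥ ⊤ F) {x y t : P} (hx : x ∈ F) (hy : y ∈ F) (ht : t ∈ F)
    (hxy : x ⋖ y) (hyt : y ⋖ t) (htop : t ≠ ⊤) (hk : key lab y t < key lab x y) :
    IsSkipped lab F {y} := by
  have h := firstStep_spec hlci (hxy.lt.trans hyt.lt)
  exact (isSkipped_singleton_iff hlab hlci hF hx hy ht hxy hyt).2
    ⟨_, h.1, h.2.1, (key_firstStep_le hlab hlci htop hxy.le hyt le_rfl).trans_lt hk⟩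

theorem not_isSkipped_of_ascent (hlab : IsEdgeLabelling lab)
    (hlci : IsLeastContentIncreasing lab) (hCL : ∀ x : P, x ≠ ⊤ → IsCLLabellingBelow lab x)
    {F : List P} (hF : SatC ⊥ ⊤ F) {x y t : P} (hx : x ∈ F) (hy : y ∈ F) (ht : t ∈ F)
    (hxy : x ⋖ y) (hyt : y ⋖ t) (htop : t ≠ ⊤) (hk : key lab x y ≤ key lab y t) :
    ¬ IsSkipped lab F {y} := by
  intro h
  obtain ⟨z, hxz, hzt, hkz⟩ := (isSkipped_singleton_iff hlab hlci hF hx hy ht hxy hyt).1 h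
  obtain ⟨m, hm⟩ := hlci.exists_satC hzt
  have h1 : SatC x t [x, y, t] := .cons hxy (.cons hyt (.single t))
  have h2 := SatC.cons hxz hm
  refine h1.not_lt_of_ascending hlab hCL htop ?_ h2 ?_
  · have hle : ∀ p ∈ [x, y, t], x ≤ p ∧ p ≤ t := fun p hp => h1.mem_bounds hp
    intro p hp r hr s hs hpr hrs
    have hry : r = y := by
      have h3 : r ≠ x := ((hle p hp).1.trans_lt hpr.lt).ne'
      have h4 : r ≠ t := (hrs.lt.trans_le (hle s hs).2).ne
      simpa [h3, h4] using hr
    subst hry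
    have hp' : p = x := by
      have h3 : p ≠ r := hpr.lt.ne
      have h4 : p ≠ t := (hpr.lt.trans hyt.lt).ne
      simpa [h3, h4] using hp
    have hs' : s = t := by
      have h3 : s ≠ r := hrs.lt.ne'
      have h4 : s ≠ x := (hxy.lt.trans hrs.lt).ne'
      simpa [h3, h4] using hs
    rw [hp', hs']
    exact hk
  · refine hlab.labelSeq_lt_of_key h2 h1 (by simp) (by simp) (by simp [hm.left_mem]) (by simp) hxz
      hxy (fun s hs => ?_) hkz
    constructor
    · intro h3
      simp [le_antisymm hs (h2.mem_bounds h3).1]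
    · intro h3
      simp [le_antisymm hs (h1.mem_bounds h3).1]

/-- A minimal skipped interval is a single element or an upper part of the facet. -/
theorem intervalSystem_cases (hlab : IsEdgeLabelling lab)
    (hlci : IsLeastContentIncreasing lab) (hCL : ∀ x : P, x ≠ ⊤ → IsCLLabellingBelow lab x)
    {F : List P} (hF : SatC ⊥ ⊤ F) {K : Finset P} (hK : K ∈ intervalSystem lab F) :
    (∃ y, K = {y}) ∨ ∃ x ∈ F, ∀ t, t ∈ K ↔ t ∈ facet F ∧ x < t := by
  classical
  obtain ⟨hKs, hmin⟩ := hK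
  obtain ⟨x, y, z, q, hx, hy, hq, hxy, hxz, hzq, hk, hsub⟩ := hKs.exists_key_lt hlab hF
  have hKeq : ∀ t, t ∈ K ↔ t ∈ facet F ∧ x < t ∧ t < q := by
    have h1 : IsSkipped lab F ((facet F).filter fun t => x < t ∧ t < q) := by
      refine isSkipped_of_key_lt hlab hlci hF hx hy hq hxy hxz hzq hk (Finset.filter_subset _ _) ?_
      intro t ht h1 h2
      exact Finset.mem_filter.2 ⟨mem_facet.2 ⟨ht, (bot_le.trans_lt h1).ne',
        (h2.trans_le le_top).ne⟩, h1, h2⟩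
    have h2 : ((facet F).filter fun t => x < t ∧ t < q) ≤ K := by
      intro t ht
      rw [Finset.mem_filter, mem_facet] at ht
      exact hsub t ht.1.1 ht.2.1 ht.2.2
    intro t
    constructor
    · intro ht
      simpa using hmin h1 h2 ht
    · intro ht
      exact h2 (by simpa using ht)
  by_cases hqt : q = ⊤
  · refine .inr ⟨x, hx, fun t => ?_⟩
    rw [hKeq, hqt]
    exact ⟨fun h => ⟨h.1, h.2.1⟩, fun h => ⟨h.1, h.2, lt_top_iff_ne_top.2 (mem_facet.1 h.1).2.2⟩⟩
  · left
    have hxq : x < q := hxz.lt.trans_le hzq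
    obtain ⟨_, e, _, he, _, _, hem⟩ := hF.split lab hx
    obtain ⟨c, _, hc, _, _, hcm, _⟩ := he.split lab ((hem q).2 ⟨hq, hxq.le⟩)
    obtain ⟨m, hm⟩ := hlci.exists_satC hzq
    have hcF : ∀ t, t ∈ c ↔ t ∈ F ∧ x ≤ t ∧ t ≤ q := fun t => by rw [hcm, hem, and_assoc]
    have hlt : labelSeq lab (x :: m) < labelSeq lab c := by
      refine hlab.labelSeq_lt_of_key (SatC.cons hxz hm) hc (by simp) hc.left_mem
        (by simp [hm.left_mem])
        ((hcF y).2 ⟨hy, hxy.le, hF.ge_of_covBy hy hxy hq hxq⟩) hxz hxy ?_ hk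
      intro t ht
      constructor
      · intro h
        rw [le_antisymm ht ((SatC.cons hxz hm).mem_bounds h).1]
        exact hc.left_mem
      · intro h
        simp [le_antisymm ht (hc.mem_bounds h).1]
    -- A part of `F` that is not lexicographically first below `q ≠ ⊤` must contain a descent, by
    -- the CL property. Its element is skipped on its own, so minimality reduces `K` to it.
    have hdesc : ∃ p ∈ c, ∃ r ∈ c, ∃ s ∈ c, p ⋖ r ∧ r ⋖ s ∧ key lab r s < key lab p r := by
      by_contra hno
      push Not at hno
      exact hc.not_lt_of_ascending hlab hCL hqt
        (fun p hp r hr s hs h1 h2 => hno p hp r hr s hs h1 h2) (SatC.cons hxz hm) hlt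
    obtain ⟨p, hp, r, hr, s, hs, hpr, hrs, hk'⟩ := hdesc
    rw [hcF] at hp hr hs
    have hsk := isSkipped_of_descent hlab hlci hF hp.1 hr.1 hs.1 hpr hrs
      (ne_top_of_le_ne_top hqt hs.2.2) hk'
    have hrK : r ∈ K := hsub r hr.1 (hp.2.1.trans_lt hpr.lt) (hrs.lt.trans_le hs.2.2)
    have hle : ({r} : Finset P) ≤ K := by simpa using hrK
    exact ⟨r, le_antisymm (hmin hsk hle) hle⟩

omit [Finite P] in
theorem singleton_mem_intervalSystem {F : List P}
    (hempty : ¬ IsSkipped lab F ∅) {y : P} (h : IsSkipped lab F {y}) :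
    {y} ∈ intervalSystem lab F := by
  refine ⟨h, fun K hK hle => ?_⟩
  rcases Finset.subset_singleton_iff.1 hle with rfl | rfl
  · exact absurd hK hempty
  · exact le_rfl

omit [Finite P] in
theorem IsSkipped.exists_mem_intervalSystem {F : List P} {K : Finset P}
    (h : IsSkipped lab F K) : ∃ K' ∈ intervalSystem lab F, K' ⊆ K := by
  have hfin : Set.Finite {K' | IsSkipped lab F K' ∧ K' ⊆ K} :=
    (K.powerset.finite_toSet).subset fun K' h => by simpa using h.2
  obtain ⟨K', hK', hmin⟩ := hfin.exists_minimal ⟨K, h, subset_rfl⟩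
  exact ⟨K', ⟨hK'.1, fun K'' h1 h2 => hmin ⟨h1, h2.trans hK'.2⟩ h2⟩, hK'.2⟩

omit [Finite P] in
/-- The new faces of `F` are the faces that meet every minimal skipped interval. -/
theorem isNewFace_iff {F : List P} (hF : IsSatChain ⊥ ⊤ F) {A : Finset P} :
    IsNewFace lab F A ↔ A ⊆ facet F ∧ ∀ K ∈ intervalSystem lab F, ∃ x ∈ K, x ∈ A := by
  constructor
  · rintro ⟨-, hA, hnew⟩
    refine ⟨hA, fun K hK => ?_⟩
    by_contra hno
    push Not at hno
    obtain ⟨-, F', hF', hlt, hsub⟩ := hK.1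
    exact hnew F' hF' hlt fun x hx => hsub (Finset.mem_sdiff.2 ⟨hA hx, fun h => hno x h hx⟩)
  · rintro ⟨hA, hmeet⟩
    refine ⟨hF, hA, fun F' hF' hlt hsub => ?_⟩
    have : IsSkipped lab F (facet F \ A) := by
      refine ⟨Finset.sdiff_subset, F', hF', hlt, fun x hx => hsub ?_⟩
      by_contra hxA
      rw [Finset.mem_sdiff] at hx
      exact hx.2 (Finset.mem_sdiff.2 ⟨hx.1, hxA⟩)
    obtain ⟨K, hK, hKsub⟩ := this.exists_mem_intervalSystem
    obtain ⟨x, hxK, hxA⟩ := hmeet K hK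
    exact (Finset.mem_sdiff.1 (hKsub hxK)).2 hxA

/-- Singletons and final segments of one chain are nested as soon as they meet, and minimal sets
cannot be properly nested. -/
theorem intervalSystem_disjoint (hlab : IsEdgeLabelling lab)
    (hlci : IsLeastContentIncreasing lab) (hCL : ∀ x : P, x ≠ ⊤ → IsCLLabellingBelow lab x)
    {F : List P} (hF : SatC ⊥ ⊤ F) {K K' : Finset P} (hK : K ∈ intervalSystem lab F)
    (hK' : K' ∈ intervalSystem lab F) {x : P} (hx : x ∈ K) (hx' : x ∈ K') : K = K' := by
  have heq : ∀ {A B : Finset P}, A ∈ intervalSystem lab F → B ∈ intervalSystem lab F →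
      A ⊆ B → A = B := fun hA hB h => le_antisymm h (hB.2 hA.1 h)
  rcases intervalSystem_cases hlab hlci hCL hF hK with ⟨y, rfl⟩ | ⟨y, hy, hyK⟩
  · rw [Finset.mem_singleton] at hx
    exact heq hK hK' (by simpa [← hx] using hx')
  rcases intervalSystem_cases hlab hlci hCL hF hK' with ⟨y', rfl⟩ | ⟨y', hy', hyK'⟩
  · rw [Finset.mem_singleton] at hx'
    exact (heq hK' hK (by simpa [← hx'] using hx)).symm
  · rcases hF.total hy hy' with h | h
    · exact (heq hK' hK fun t ht => (hyK t).2 ⟨((hyK' t).1 ht).1, h.trans_lt ((hyK' t).1 ht).2⟩).symm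
    · exact heq hK hK' fun t ht => (hyK' t).2 ⟨((hyK t).1 ht).1, h.trans_lt ((hyK t).1 ht).2⟩

end Skipped

/-! ### Truncation and pivots -/

section Truncation

variable {P : Type*} [DecidableEq P] {𝓘 : Set (Finset P)}

theorem truncate_eq_diff (hd : ∀ A ∈ 𝓘, ∀ B ∈ 𝓘, ∀ x ∈ A, x ∈ B → A = B)
    (hne : ∀ A ∈ 𝓘, A.Nonempty) {I : Finset P} (hI : I ∈ 𝓘) : truncate 𝓘 I = 𝓘 \ {I} := by
  have hsd : ∀ A ∈ 𝓘, A ≠ I → A \ I = A := fun A hA hAI =>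
    Finset.sdiff_eq_self_of_disjoint (Finset.disjoint_left.2 fun x h1 h2 =>
      hAI (hd A hA I hI x h1 h2))
  ext K
  constructor
  · rintro ⟨⟨I', hI', hne', rfl⟩, -⟩
    rw [hsd I' hI' hne']
    exact ⟨hI', hne'⟩
  · rintro ⟨hK, hKI⟩
    refine ⟨⟨K, hK, hKI, (hsd K hK hKI).symm⟩, ?_⟩
    rintro _ ⟨I', hI', hne', rfl⟩ hle
    rw [hsd I' hI' hne'] at hle ⊢
    obtain ⟨x, hx⟩ := hne I' hI'
    exact (hd I' hI' K hK x hx (hle hx)).ge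

variable [PartialOrder P] [BoundedOrder P]

omit [BoundedOrder P] in
theorem TruncatesTo.mem_iff {𝓙 : List (Finset P)} (h : TruncatesTo 𝓘 𝓙)
    (hd : ∀ A ∈ 𝓘, ∀ B ∈ 𝓘, ∀ x ∈ A, x ∈ B → A = B) (hne : ∀ A ∈ 𝓘, A.Nonempty)
    (K : Finset P) : K ∈ 𝓙 ↔ K ∈ 𝓘 := by
  induction h with
  | nil => simp
  | @cons 𝓘 I 𝓙 hI _ _ ih =>
    rw [truncate_eq_diff hd hne hI] at ih
    have ih := ih (fun A hA B hB => hd A hA.1 B hB.1) (fun A hA => hne A hA.1)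
    rw [List.mem_cons, ih]
    by_cases h : K = I
    · simp [h, hI]
    · simp [h]

omit [BoundedOrder P] in
theorem exists_truncatesTo [Finite P] (hd : ∀ A ∈ 𝓘, ∀ B ∈ 𝓘, ∀ x ∈ A, x ∈ B → A = B)
    (hne : ∀ A ∈ 𝓘, A.Nonempty)
    (htot : ∀ A ∈ 𝓘, ∀ B ∈ 𝓘, ∀ x ∈ A, ∀ y ∈ B, x ≤ y ∨ y ≤ x) : ∃ 𝓙, TruncatesTo 𝓘 𝓙 := by
  have := Fintype.ofFinite P
  have hfin : 𝓘.Finite := Set.toFinite _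
  induction hn : 𝓘.ncard generalizing 𝓘 with
  | zero =>
    rw [Set.ncard_eq_zero hfin] at hn
    exact ⟨[], hn ▸ .nil⟩
  | succ n ih =>
    obtain ⟨A, hA⟩ := (Set.ncard_pos hfin).1 (by omega)
    obtain ⟨a, ha⟩ := hne A hA
    obtain ⟨x, ⟨I, hI, hxI⟩, hmin⟩ := Set.Finite.exists_minimal (s := {x | ∃ I ∈ 𝓘, x ∈ I})
      (Set.toFinite _) ⟨a, A, hA, ha⟩
    obtain ⟨𝓙, h𝓙⟩ := ih (𝓘 := 𝓘 \ {I}) (fun A hA B hB => hd A hA.1 B hB.1)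
      (fun A hA => hne A hA.1) (fun A hA B hB => htot A hA.1 B hB.1) (Set.toFinite _)
      (by rw [Set.ncard_sdiff_singleton_of_mem hI]; omega)
    refine ⟨I :: 𝓙, .cons hI ⟨x, hxI, fun K hK y hy => ?_⟩
      (by rwa [truncate_eq_diff hd hne hI])⟩
    rcases htot I hI K hK x hxI y hy with h | h
    · exact h
    · exact hmin ⟨K, hK, hy⟩ h

end Truncation

/-! ### Pivots and the shape of critical cells -/

section Pivot

variable {P : Type*} [PartialOrder P] [BoundedOrder P] [DecidableEq P] [Finite P] {L : Type*}
  [LinearOrder L] {lab : P → P → Option L}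

theorem intervalSystem_nonempty (hlab : IsEdgeLabelling lab) {F : List P} (hF : SatC ⊥ ⊤ F)
    {K : Finset P} (hK : K ∈ intervalSystem lab F) : K.Nonempty := by
  rw [Finset.nonempty_iff_ne_empty]
  rintro rfl
  exact not_isSkipped_empty hlab hF hK.1

omit [Finite P] in
theorem mem_of_isSkipped_singleton {F : List P} {A : Finset P} (hA : IsNewFace lab F A) {y : P}
    (hy : IsSkipped lab F {y}) : y ∈ A := by
  by_contra hyA
  obtain ⟨-, F', hF', hlt, hsub⟩ := hy
  refine hA.2.2 F' hF' hlt fun x hx => hsub (Finset.mem_sdiff.2 ⟨hA.2.1 hx, ?_⟩)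
  rw [Finset.mem_singleton]
  rintro rfl
  exact hyA hx

theorem upper_of_not_isSkipped (hlab : IsEdgeLabelling lab)
    (hlci : IsLeastContentIncreasing lab) (hCL : ∀ x : P, x ≠ ⊤ → IsCLLabellingBelow lab x)
    {F : List P} (hF : SatC ⊥ ⊤ F) {K : Finset P} (hK : K ∈ intervalSystem lab F) {y : P}
    (hyK : y ∈ K) (hy : ¬ IsSkipped lab F {y}) :
    ∃ x ∈ F, ∀ t, t ∈ K ↔ t ∈ facet F ∧ x < t := by
  refine (intervalSystem_cases hlab hlci hCL hF hK).resolve_left ?_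
  rintro ⟨z, rfl⟩
  obtain rfl := Finset.mem_singleton.1 hyK
  exact hy hK.1

/-- An element inserted by the matching is the lowest element of the facet that is not a skipped
singleton. -/
theorem IsPivot.isLeast (hlab : IsEdgeLabelling lab)
    (hlci : IsLeastContentIncreasing lab) (hCL : ∀ x : P, x ≠ ⊤ → IsCLLabellingBelow lab x)
    {F : List P} {A : Finset P} {v : P} (hA : IsNewFace lab F A) (hv : IsPivot lab F A v)
    (hvA : v ∉ A) : IsLeast {y | y ∈ facet F ∧ ¬ IsSkipped lab F {y}} v := by
  have hF := isSatChain_iff.1 hA.1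
  have hempty := not_isSkipped_empty hlab hF
  have hns : ¬ IsSkipped lab F {v} := fun h => hvA (mem_of_isSkipped_singleton hA h)
  rcases hv with ⟨⟨hvF, hcone⟩, hleast⟩ | ⟨hcov, 𝓙, h𝓙, hcase⟩
  · refine ⟨⟨hvF, hns⟩, ?_⟩
    rintro y ⟨hyF, hyns⟩
    by_cases hy : ∀ K ∈ intervalSystem lab F, y ∉ K
    · exact hleast ⟨hyF, hy⟩
    · push Not at hy
      obtain ⟨K, hK, hyK⟩ := hy
      obtain ⟨x, -, hx⟩ := upper_of_not_isSkipped hlab hlci hCL hF hK hyK hyns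
      rcases hF.lt_or_le (mem_facet.1 hyF).1 (mem_facet.1 hvF).1 with h | h
      · exact absurd ((hx v).2 ⟨hvF, ((hx y).1 hyK).2.trans h⟩) (hcone K hK)
      · exact h
  · have hmem := h𝓙.mem_iff
      (fun A hA B hB x h1 h2 => intervalSystem_disjoint hlab hlci hCL hF hA hB h1 h2)
      (fun A hA => intervalSystem_nonempty hlab hF hA)
    rcases hcase with ⟨𝓙₁, J, 𝓙₂, rfl, -, ⟨hvJ, hleast⟩, -⟩ | ⟨-, ⟨hvF, hno⟩, -⟩
    · have hJ := (hmem J).1 (by simp)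
      rw [Finset.mem_coe] at hvJ
      obtain ⟨x, hxF, hx⟩ := upper_of_not_isSkipped hlab hlci hCL hF hJ hvJ hns
      refine ⟨⟨((hx v).1 hvJ).1, hns⟩, ?_⟩
      rintro y ⟨hyF, hyns⟩
      obtain ⟨K, hK, hyK⟩ := hcov y hyF
      obtain ⟨x', hx'F, hx'⟩ := upper_of_not_isSkipped hlab hlci hCL hF hK hyK hyns
      rcases hF.lt_or_le (mem_facet.1 hyF).1 (mem_facet.1 ((hx v).1 hvJ).1).1 with h | h
      -- A final segment containing a lower element `y` would contain `v` as well, hence be `J`,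
      -- whose lowest element is `v`.
      · have hvK : v ∈ K := (hx' v).2 ⟨((hx v).1 hvJ).1, ((hx' y).1 hyK).2.trans h⟩
        obtain rfl := intervalSystem_disjoint hlab hlci hCL hF hJ hK hvJ hvK
        exact hleast hyK
      · exact h
    · obtain ⟨K, hK, hvK⟩ := hcov v hvF
      exact absurd hvK (hno K ((hmem K).2 hK))

omit [Finite P] in
/-- If `v` is the pivot of both `A` and `A \ v`, then `A` is matched. -/
theorem Contributes.false_of_isPivot {F : List P} {A : Finset P} (hA : Contributes lab F A) {v : P}
    (hvF : v ∈ facet F) (hpiv : IsPivot lab F A v) (hpiv' : IsPivot lab F (A.erase v) v)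
    (hmeet : ∀ K ∈ intervalSystem lab F, v ∈ K → v ∈ A → ∃ x ∈ K, x ≠ v ∧ x ∈ A) : False := by
  obtain ⟨hnew, -, hcrit⟩ := hA
  by_cases hv : v ∈ A
  · refine (hcrit (A.erase v)).2 ⟨F, v, ?_, hpiv', Finset.notMem_erase v A,
      (Finset.insert_erase hv).symm⟩
    obtain ⟨hsub, hm⟩ := (isNewFace_iff hnew.1).1 hnew
    refine (isNewFace_iff hnew.1).2 ⟨(Finset.erase_subset _ _).trans hsub, fun K hK => ?_⟩
    by_cases hvK : v ∈ K
    · obtain ⟨x, h1, h2, h3⟩ := hmeet K hK hvK hv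
      exact ⟨x, h1, Finset.mem_erase.2 ⟨h2, h3⟩⟩
    · obtain ⟨x, h1, h2⟩ := hm K hK
      exact ⟨x, h1, Finset.mem_erase.2 ⟨by rintro rfl; exact hvK h1, h2⟩⟩
  · exact (hcrit (insert v A)).1 ⟨F, v, hnew, hpiv, hv, rfl⟩

omit [Finite P] in
theorem SatC.exists_isLeast {F : List P} (hF : SatC ⊥ ⊤ F) {s : Set P} (hs : ∀ x ∈ s, x ∈ F)
    (hne : s.Nonempty) : ∃ v, IsLeast s v := by
  have hfin : s.Finite := F.toFinset.finite_toSet.subset fun x hx => by simpa using hs x hx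
  obtain ⟨v, hv, hmin⟩ := hfin.exists_minimal hne
  refine ⟨v, hv, fun y hy => ?_⟩
  rcases hF.total (hs v hv) (hs y hy) with h | h
  · exact h
  · exact hmin hy h

omit [Finite P] in
-- The lowest cone point would be the pivot of every new face of `F`, with or without that point, so
-- no cell would be left unmatched.
theorem Contributes.covered {F : List P} {A : Finset P} (hA : Contributes lab F A) :
    ∀ x ∈ facet F, ∃ K ∈ intervalSystem lab F, x ∈ K := by
  by_contra hno
  push Not at hno
  obtain ⟨x, hx, hxK⟩ := hno
  obtain ⟨v, hv⟩ := (isSatChain_iff.1 hA.1.1).exists_isLeast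
    (s := {x | x ∈ facet F ∧ ∀ K ∈ intervalSystem lab F, x ∉ K})
    (fun x hx => (mem_facet.1 hx.1).1) ⟨x, hx, hxK⟩
  exact hA.false_of_isPivot hv.1.1 (.inl hv) (.inl hv) fun K hK hvK => absurd hvK (hv.1.2 K hK)

/-- A critical cell contributed by `F` consists of the skipped singletons of `F` and of the lowest
other element; the other elements lie above the skipped singletons. -/
theorem Contributes.mem_iff (hlab : IsEdgeLabelling lab)
    (hlci : IsLeastContentIncreasing lab) (hCL : ∀ x : P, x ≠ ⊤ → IsCLLabellingBelow lab x)
    {F : List P} {A : Finset P} (hA : Contributes lab F A) :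
    (∀ y ∈ facet F, y ∈ A ↔ IsSkipped lab F {y} ∨
      ∀ v ∈ facet F, ¬ IsSkipped lab F {v} → y ≤ v) ∧
    ∀ y ∈ facet F, ∀ t ∈ facet F, ¬ IsSkipped lab F {y} → y ≤ t → ¬ IsSkipped lab F {t} := by
  have hF := isSatChain_iff.1 hA.1.1
  have hcov := hA.covered
  have hdis := fun {K K'} hK hK' {x} => intervalSystem_disjoint hlab hlci hCL hF
    (K := K) (K' := K') hK hK' (x := x)
  have hsing : ∀ {y}, IsSkipped lab F {y} → {y} ∈ intervalSystem lab F := fun h =>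
    singleton_mem_intervalSystem (not_isSkipped_empty hlab hF) h
  by_cases hall : ∀ y ∈ facet F, IsSkipped lab F {y}
  · refine ⟨fun y hy => ?_, fun y hy t ht h => absurd (hall y hy) h⟩
    simp [mem_of_isSkipped_singleton hA.1 (hall y hy), hall y hy]
  push Not at hall
  obtain ⟨y₀, hy₀, hns₀⟩ := hall
  obtain ⟨J, hJ, hy₀J⟩ := hcov y₀ hy₀
  obtain ⟨x, hxF, hx⟩ := upper_of_not_isSkipped hlab hlci hCL hF hJ hy₀J hns₀
  have hJns : ∀ t ∈ J, ¬ IsSkipped lab F {t} := by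
    intro t ht hs
    obtain rfl := hdis hJ (hsing hs) ht (Finset.mem_singleton_self t)
    rw [Finset.mem_singleton] at hy₀J
    exact hns₀ (hy₀J ▸ hs)
  have hnsJ : ∀ t ∈ facet F, ¬ IsSkipped lab F {t} → t ∈ J := by
    intro t ht hs
    obtain ⟨K, hK, htK⟩ := hcov t ht
    obtain ⟨x', hx'F, hx'⟩ := upper_of_not_isSkipped hlab hlci hCL hF hK htK hs
    have : J = K := by
      rcases hF.total (mem_facet.1 hy₀).1 (mem_facet.1 ht).1 with h | h
      · exact hdis hJ hK ((hx t).2 ⟨ht, ((hx y₀).1 hy₀J).2.trans_le h⟩) htK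
      · exact hdis hJ hK hy₀J ((hx' y₀).2 ⟨hy₀, ((hx' t).1 htK).2.trans_le h⟩)
    exact this ▸ htK
  obtain ⟨v, hv⟩ := hF.exists_isLeast (s := (J : Set P))
    (fun t ht => (mem_facet.1 ((hx t).1 ht).1).1) ⟨y₀, hy₀J⟩
  have hvJ : v ∈ J := hv.1
  -- Otherwise `v` is the pivot both of `A` and of `A.erase v`, which makes `A` matched. All
  -- intervals listed before `J` are singletons contained in the face, since a second final segment
  -- would meet `J`.
  have hint : A ∩ J = {v} := by
    by_contra hne
    have hpiv : ∀ B : Finset P, B ∩ J ≠ {v} → (∀ t, IsSkipped lab F {t} → t ∈ B) →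
        IsPivot lab F B v := by
      intro B hB hsk
      obtain ⟨𝓙, h𝓙⟩ := exists_truncatesTo (𝓘 := intervalSystem lab F)
        (fun A hA B hB x h1 h2 => hdis hA hB h1 h2)
        (fun A hA => intervalSystem_nonempty hlab hF hA)
        (fun A hA B hB x h1 y h2 => hF.total (mem_facet.1 (hA.1.1 h1)).1
          (mem_facet.1 (hB.1.1 h2)).1)
      have hmem := h𝓙.mem_iff (fun A hA B hB x h1 h2 => hdis hA hB h1 h2)
        (fun A hA => intervalSystem_nonempty hlab hF hA)
      obtain ⟨𝓙₁, 𝓙₂, rfl, hJ₁⟩ := List.eq_append_cons_of_mem ((hmem J).2 hJ)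
      refine .inr ⟨hcov, _, h𝓙, .inl ⟨𝓙₁, J, 𝓙₂, rfl, fun K hK => ?_, hv, hB⟩⟩
      have hKs := (hmem K).1 (by simp [hK])
      rcases intervalSystem_cases hlab hlci hCL hF hKs with ⟨t, rfl⟩ | ⟨x', hx'F, hx'⟩
      · exact ⟨t, by simp, Finset.inter_singleton_of_mem (hsk t hKs.1)⟩
      · exfalso
        obtain ⟨t, ht⟩ := intervalSystem_nonempty hlab hF hKs
        have htK := (hx' t).1 ht
        have htop : ∃ s, s ∈ K ∧ s ∈ J := by
          rcases hF.total (mem_facet.1 hy₀).1 (mem_facet.1 htK.1).1 with h | h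
          · exact ⟨t, ht, (hx t).2 ⟨htK.1, ((hx y₀).1 hy₀J).2.trans_le h⟩⟩
          · exact ⟨y₀, (hx' y₀).2 ⟨hy₀, htK.2.trans_le h⟩, hy₀J⟩
        obtain ⟨s, h1, h2⟩ := htop
        exact hJ₁ (hdis hJ hKs h2 h1 ▸ hK)
    have hsk := fun t ht => mem_of_isSkipped_singleton hA.1 (y := t) ht
    refine hA.false_of_isPivot ((hx v).1 hvJ).1 (hpiv A hne hsk) (hpiv _ ?_ ?_) ?_
    · intro h
      have : v ∈ A.erase v ∩ J := h ▸ Finset.mem_singleton_self v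
      simp at this
    · intro t ht
      refine Finset.mem_erase.2 ⟨?_, hsk t ht⟩
      rintro rfl
      exact hJns t hvJ ht
    · intro K hK hvK hvA
      obtain rfl := hdis hJ hK hvJ hvK
      by_contra hno
      push Not at hno
      refine hne (Finset.ext fun t => ?_)
      rw [Finset.mem_inter, Finset.mem_singleton]
      constructor
      · rintro ⟨h1, h2⟩
        by_contra h
        exact hno t h2 h h1
      · rintro rfl
        exact ⟨hvA, hvJ⟩
  constructor
  · intro y hy
    constructor
    · intro hyA
      by_cases hs : IsSkipped lab F {y}
      · exact .inl hs
      · refine .inr fun t ht hst => ?_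
        have : y ∈ A ∩ J := Finset.mem_inter.2 ⟨hyA, hnsJ y hy hs⟩
        rw [hint, Finset.mem_singleton] at this
        exact this ▸ hv.2 (hnsJ t ht hst)
    · rintro (hs | hle)
      · exact mem_of_isSkipped_singleton hA.1 hs
      · by_cases hs : IsSkipped lab F {y}
        · exact mem_of_isSkipped_singleton hA.1 hs
        · have hyv : y = v :=
            le_antisymm (hle v ((hx v).1 hvJ).1 (hJns v hvJ)) (hv.2 (hnsJ y hy hs))
          have : v ∈ A ∩ J := hint ▸ Finset.mem_singleton_self v
          exact hyv ▸ (Finset.mem_inter.1 this).1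
  · intro y hy t ht hs hyt
    exact hJns t ((hx t).2 ⟨ht, ((hx y).1 (hnsJ y hy hs)).2.trans_le hyt⟩)

end Pivot

/-! ### Sequences of moves -/

section Moves

variable {P : Type*} [PartialOrder P] [BoundedOrder P] {L : Type*} [LinearOrder L]
  {lab : P → P → Option L}

/-- A chain with `m + 1` interior elements. -/
structure IsState (m : ℕ) (q : ℕ → P) : Prop where
  bot : q 0 = ⊥
  top : q (m + 2) = ⊤
  lt : ∀ i < m + 2, q i < q (i + 1)

/-- Replace `q (l + 1)` by the first element above `q l` of the lexicographically smallest chain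
from `q l` to `q (l + 2)`. -/
noncomputable def advance (lab : P → P → Option L) (q : ℕ → P) (l : ℕ) : ℕ → P :=
  Function.update q (l + 1) (firstStep lab (q l) (q (l + 2)))

/-- The first label of the lexicographically smallest chain from `q l` to `q (l + 1)`. -/
noncomputable def stepKey (lab : P → P → Option L) (q : ℕ → P) (l : ℕ) : WithBot L :=
  key lab (q l) (firstStep lab (q l) (q (l + 1)))

noncomputable def runMoves (lab : P → P → Option L) : (ℕ → P) → List ℕ → (ℕ → P)
  | q, [] => q
  | q, l :: ops => runMoves lab (advance lab q l) ops

/-- The moves `ops` lead from `q` to a chain that begins with `z 0, …, z m`. -/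
inductive MovePath (lab : P → P → Option L) (m : ℕ) (z : ℕ → P) : (ℕ → P) → List ℕ → Prop
  | done {q : ℕ → P} : (∀ i ≤ m, q i = z i) → MovePath lab m z q []
  | step {q : ℕ → P} {l : ℕ} {ops : List ℕ} : l ≤ m → firstStep lab (q l) (q (l + 2)) ≠ q (l + 1) →
      ¬ (l = m ∧ ∀ i ≤ m, q i = z i) → MovePath lab m z (advance lab q l) ops →
      MovePath lab m z q (l :: ops)

/-- A saturated chain with decreasing labels. -/
structure IsTarget (lab : P → P → Option L) (m : ℕ) (z : ℕ → P) : Prop where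
  bot : z 0 = ⊥
  covBy : ∀ i < m, z i ⋖ z (i + 1)
  anti : ∀ i, i + 1 < m → key lab (z (i + 1)) (z (i + 2)) < key lab (z i) (z (i + 1))

theorem IsState.ne_top {m : ℕ} {q : ℕ → P} (hq : IsState m q) {i : ℕ} (hi : i < m + 2) :
    q i ≠ ⊤ := ((hq.lt i hi).trans_le le_top).ne

theorem IsState.lt_two {m : ℕ} {q : ℕ → P} (hq : IsState m q) {l : ℕ} (hl : l ≤ m) :
    q l < q (l + 2) :=
  (hq.lt l (by omega)).trans (hq.lt (l + 1) (by omega))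

omit [BoundedOrder P] in
theorem advance_self (q : ℕ → P) (l : ℕ) :
    advance lab q l (l + 1) = firstStep lab (q l) (q (l + 2)) := by simp [advance]

omit [BoundedOrder P] in
theorem advance_of_ne {q : ℕ → P} {l i : ℕ} (h : i ≠ l + 1) : advance lab q l i = q i := by
  simp [advance, h]

omit [BoundedOrder P] in
theorem stepKey_advance_of_ne {q : ℕ → P} {l k : ℕ} (h : k ≠ l) (h' : k ≠ l + 1) :
    stepKey lab (advance lab q l) k = stepKey lab q k := by
  rw [stepKey, stepKey, advance_of_ne h', advance_of_ne (by omega)]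

theorem IsTarget.key_anti {m : ℕ} {z : ℕ → P} (hz : IsTarget lab m z) {i j : ℕ}
    (hij : i ≤ j) (hj : j < m) : key lab (z j) (z (j + 1)) ≤ key lab (z i) (z (i + 1)) := by
  induction j, hij using Nat.le_induction with
  | base => rfl
  | succ j hij ih => exact (hz.anti j hj).le.trans (ih (by omega))

variable [Finite P]

/-! ### How the first labels change under moves -/

section

variable (hlab : IsEdgeLabelling lab) (hlci : IsLeastContentIncreasing lab) {m : ℕ} {q : ℕ → P}

include hlci

theorem IsState.advance (hq : IsState m q) {l : ℕ} (hl : l ≤ m) : IsState m (advance lab q l) := by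
  have h2 := hq.lt_two hl
  obtain ⟨hc, hle, -⟩ := firstStep_spec hlci h2
  refine ⟨by rw [advance_of_ne (by omega), hq.bot], by rw [advance_of_ne (by omega), hq.top],
    fun i hi => ?_⟩
  by_cases h1 : i = l
  · subst h1
    rw [advance_self, advance_of_ne (by omega)]
    exact hc.lt
  by_cases h2 : i = l + 1
  · subst h2
    rw [advance_self, advance_of_ne (by omega)]
    refine hle.lt_of_ne fun h => ?_
    exact (h ▸ hc).2 (hq.lt l (by omega)) (hq.lt (l + 1) hi)
  · rw [advance_of_ne h2, advance_of_ne (by omega)]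
    exact hq.lt i hi

omit [BoundedOrder P] in
theorem stepKey_of_covBy {l : ℕ} (h : q l ⋖ q (l + 1)) :
    stepKey lab q l = key lab (q l) (q (l + 1)) := by
  rw [stepKey, firstStep_eq_of_covBy hlci h]

theorem stepKey_advance_self (hq : IsState m q) {l : ℕ} (hl : l ≤ m) :
    stepKey lab (advance lab q l) l = key lab (q l) (firstStep lab (q l) (q (l + 2))) := by
  have h := (firstStep_spec hlci (hq.lt_two hl)).1
  rw [stepKey_of_covBy hlci, advance_self, advance_of_ne (by omega)]
  rwa [advance_self, advance_of_ne (by omega)]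

theorem stepKey_advance_le (hq : IsState m q) {l : ℕ} (hl : l ≤ m) :
    stepKey lab (advance lab q l) l ≤ stepKey lab q l := by
  rw [stepKey_advance_self hlci hq hl]
  have h := firstStep_spec hlci (hq.lt l (by omega))
  exact (firstStep_spec hlci (hq.lt_two hl)).2.2 _ h.1
    (h.2.1.trans (hq.lt (l + 1) (by omega)).le)

include hlab

/-- With `l < m` the end `q (l + 2)` stays below `⊤`, so the first label of the least chain bounds
every label of the interval, in particular those above `q (l + 1)`. -/
theorem stepKey_advance_le_succ (hq : IsState m q) {l : ℕ} (hl : l < m) :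
    stepKey lab (advance lab q l) l ≤ stepKey lab q (l + 1) := by
  rw [stepKey_advance_self hlci hq hl.le]
  have h := firstStep_spec hlci (hq.lt (l + 1) (by omega))
  exact key_firstStep_le hlab hlci (hq.ne_top (by omega)) (hq.lt l (by omega)).le h.1 h.2.1

/-- The least chain starts with the smallest label of the interval, so whatever follows the inserted
element has a label at least as large. -/
theorem stepKey_advance_ascent (hq : IsState m q) {l : ℕ} (hl : l < m) :
    stepKey lab (advance lab q l) l ≤ stepKey lab (advance lab q l) (l + 1) := by
  have hq' := hq.advance hlci hl.le
  have h := firstStep_spec hlci (hq'.lt (l + 1) (by omega))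
  rw [stepKey_advance_self hlci hq hl.le]
  have h1 := hq'.lt l (by omega)
  have e1 : advance lab q l l = q l := advance_of_ne (by omega)
  have e2 : advance lab q l (l + 1 + 1) = q (l + 2) := advance_of_ne (by omega)
  rw [e1] at h1
  rw [e2] at h
  rw [stepKey, e2]
  exact key_firstStep_le hlab hlci (hq.ne_top (by omega)) h1.le h.1 h.2.1

theorem stepKey_advance_lt (hq : IsState m q) {l : ℕ} (hl : l ≤ m) (hc : q l ⋖ q (l + 1))
    (hne : firstStep lab (q l) (q (l + 2)) ≠ q (l + 1)) :
    stepKey lab (advance lab q l) l < key lab (q l) (q (l + 1)) := by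
  rw [stepKey_advance_self hlci hq hl]
  have h := firstStep_spec hlci (hq.lt_two hl)
  exact (h.2.2 _ hc (hq.lt (l + 1) (by omega)).le).lt_of_ne (hlab.key_ne h.1 hc hne)

variable {z : ℕ → P} {ops : List ℕ} (hz : IsTarget lab m z)

include hz

/-- The labels of the target are bounded by all earlier prefix minima. -/
theorem MovePath.target_le (h : MovePath lab m z q ops) (hq : IsState m q) {k l : ℕ} (hlk : l ≤ k)
    (hk : k < m) : key lab (z k) (z (k + 1)) ≤ stepKey lab q l := by
  induction h generalizing l with
  | done h =>
    have e1 := h l (by omega)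
    have e2 := h (l + 1) (by omega)
    rw [stepKey_of_covBy hlci (by rw [e1, e2]; exact hz.covBy l (by omega)), e1, e2]
    exact hz.key_anti hlk hk
  | @step q o ops ho hne _ _ ih =>
    have ih := fun {l} => ih (hq.advance hlci ho) (l := l)
    by_cases h1 : l = o
    · subst h1
      exact (ih hlk).trans (stepKey_advance_le hlci hq ho)
    by_cases h2 : l = o + 1
    · subst h2
      exact (ih (by omega)).trans (stepKey_advance_le_succ hlab hlci hq (by omega))
    · exact (ih hlk).trans_eq (stepKey_advance_of_ne h1 h2)

/-- The first move at `k` brings the label bound from `k + 1` down to `k`, where the bound by prefix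
minima takes over. Before that move, `stepKey` at `k + 1` can only decrease. -/
theorem MovePath.target_le_succ (h : MovePath lab m z q ops) (hq : IsState m q) {k : ℕ}
    (hk : k < m) (hmem : k ∈ ops) : key lab (z k) (z (k + 1)) ≤ stepKey lab q (k + 1) := by
  induction h with
  | done => simp at hmem
  | @step q o ops ho hne _ hp ih =>
    have hq' := hq.advance (lab := lab) hlci ho
    by_cases h1 : o = k
    · subst h1
      exact (hp.target_le hlab hlci hz hq' le_rfl hk).trans
        (stepKey_advance_le_succ hlab hlci hq hk)
    · refine (ih hq' ((List.mem_cons.1 hmem).resolve_left (Ne.symm h1))).trans ?_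
      by_cases h2 : o = k + 1
      · subst h2
        exact stepKey_advance_le hlci hq ho
      · exact (stepKey_advance_of_ne (by omega) (by omega)).le

/-- An ascent below `k` never dies out: a move below `k` creates one at its own position, and a move
above `k` does not touch the labels concerned. The target has none. -/
theorem MovePath.false_of_ascent (h : MovePath lab m z q ops) (hq : IsState m q) {k l : ℕ}
    (hk : k < m) (hmem : k ∉ ops) (hl : l < k) (hasc : stepKey lab q l ≤ stepKey lab q (l + 1)) :
    False := by
  induction h generalizing l with
  | done h =>
    have e1 := h l (by omega)
    have e2 := h (l + 1) (by omega)
    have e3 := h (l + 1 + 1) (by omega)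
    rw [stepKey_of_covBy hlci (by rw [e1, e2]; exact hz.covBy l (by omega)),
      stepKey_of_covBy hlci (by rw [e3, e2]; exact hz.covBy (l + 1) (by omega)), e1, e2, e3] at hasc
    exact (hz.anti l (by omega)).not_ge hasc
  | @step q o ops ho hne _ hp ih =>
    rw [List.mem_cons, not_or] at hmem
    have ih := fun {l} => ih (hq.advance hlci ho) hmem.2 (l := l)
    rcases lt_or_gt_of_ne hmem.1 with h1 | h1
    · refine ih hl ?_
      rwa [stepKey_advance_of_ne (by omega) (by omega), stepKey_advance_of_ne (by omega) (by omega)]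
    · exact ih h1 (stepKey_advance_ascent hlab hlci hq (by omega))

/-- Any move below `k` would leave an ascent that survives to the end, so the part up to `k + 1` is
never altered. -/
theorem MovePath.eq_target_of_notMem (h : MovePath lab m z q ops) (hq : IsState m q) {k : ℕ}
    (hk : k < m) (hmem : k ∉ ops) : ∀ i ≤ k + 1, q i = z i := by
  induction h with
  | done h => exact fun i hi => h i (by omega)
  | @step q o ops ho hne _ hp ih =>
    rw [List.mem_cons, not_or] at hmem
    rcases lt_or_gt_of_ne hmem.1 with h1 | h1
    · intro i hi
      rw [← ih (hq.advance hlci ho) hmem.2 i hi, advance_of_ne (by omega)]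
    · exact (hp.false_of_ascent hlab hlci hz (hq.advance hlci ho) hk hmem.2 h1
        (stepKey_advance_ascent hlab hlci hq (by omega))).elim

/-- A move cannot change a part of the chain that agrees with the target. -/
theorem MovePath.false_of_move (hq : IsState m q) {o : ℕ} (ho : o < m)
    (hne : firstStep lab (q o) (q (o + 2)) ≠ q (o + 1)) (h1 : q o = z o)
    (h2 : q (o + 1) = z (o + 1)) (hp : MovePath lab m z (LexMorse.advance lab q o) ops) : False := by
  have hlt := stepKey_advance_lt hlab hlci hq ho.le (by rw [h1, h2]; exact hz.covBy o ho) hne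
  rw [h1, h2] at hlt
  exact hlt.not_ge (hp.target_le hlab hlci hz (hq.advance hlci ho.le) le_rfl ho)

/-- A further move would either lower a label strictly below that of the target or delete the last
element and land on the target cell itself, which the definition of a path excludes. -/
theorem MovePath.eq_nil (h : MovePath lab m z q ops) (hq : IsState m q)
    (heq : ∀ i ≤ m, q i = z i) : ops = [] := by
  cases h with
  | done => rfl
  | @step _ o ops ho hne hcrit hp =>
    rcases ho.eq_or_lt with h1 | h1
    · exact absurd ⟨h1, heq⟩ hcrit
    · exact (MovePath.false_of_move hlab hlci hz hq h1 hne (heq o ho)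
        (heq (o + 1) (by omega)) hp).elim

end

/-- If the last label of `q` equals the last label of the target, then the last interior element
is never moved. -/
theorem MovePath.run_last (hlab : IsEdgeLabelling lab) (hlci : IsLeastContentIncreasing lab)
    {m : ℕ} {z : ℕ → P} (hz : IsTarget lab (m + 1) z) {q : ℕ → P} {ops : List ℕ}
    (h : MovePath lab (m + 1) z q ops) (hq : IsState (m + 1) q) (hcov : q (m + 1) ⋖ q (m + 2))
    (hkey : key lab (q (m + 1)) (q (m + 2)) = key lab (z m) (z (m + 1))) (hmem : m ∈ ops) :
    runMoves lab q ops (m + 2) = q (m + 2) := by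
  induction h with
  | done => simp at hmem
  | @step q o ops ho hne hcrit hp ih =>
    have hq' := hq.advance (lab := lab) hlci ho
    rcases Nat.lt_trichotomy o m with h1 | rfl | h1
    · have := ih hq' (by rwa [advance_of_ne (by omega), advance_of_ne (by omega)])
        (by rwa [advance_of_ne (by omega), advance_of_ne (by omega)])
        ((List.mem_cons.1 hmem).resolve_left (by omega))
      rw [runMoves, this, advance_of_ne (by omega)]
    -- At a move at `m` the new first label is squeezed between the target label and the last label
    -- of `q`, which coincide. A later move at the preceding position would then contradict the
    -- strict decrease of the target, so the target is reached at once.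
    · have hle := stepKey_advance_le_succ hlab hlci hq (Nat.lt_succ_self o)
      rw [stepKey_of_covBy hlci hcov, hkey] at hle
      have heq := le_antisymm hle (hp.target_le hlab hlci hz hq' le_rfl (Nat.lt_succ_self o))
      have hpre : ∀ i ≤ o, q i = z i := by
        intro i hi
        cases o with
        | zero =>
          obtain rfl : i = 0 := by omega
          rw [hq.bot, hz.bot]
        | succ o =>
          have hno : o ∉ ops := by
            intro ho'
            exact (hz.anti o (by omega)).not_ge
              ((hp.target_le_succ hlab hlci hz hq' (by omega) ho').trans_eq heq)
          rw [← hp.eq_target_of_notMem hlab hlci hz hq' (by omega) hno i hi,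
            advance_of_ne (by omega)]
      have hfs := (firstStep_spec hlci (hq.lt_two ho)).1
      rw [stepKey_advance_self hlci hq ho] at heq
      have hfz : firstStep lab (q o) (q (o + 2)) = z (o + 1) := by
        by_contra hne'
        have hcz := hz.covBy o (by omega)
        rw [← hpre o le_rfl] at hcz heq
        exact hlab.key_ne hfs hcz hne' heq
      have hnil : ops = [] := by
        refine hp.eq_nil hlab hlci hz hq' fun i hi => ?_
        by_cases hi' : i = o + 1
        · subst hi'
          rw [advance_self, hfz]
        · rw [advance_of_ne hi', hpre i (by omega)]
      rw [hnil, runMoves, runMoves, advance_of_ne (by omega)]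
    -- Moving the last element lowers its label strictly below the target label at `m`, but a move
    -- at `m` is still to come and needs that label as an upper bound.
    · obtain rfl : o = m + 1 := by omega
      have hlt := stepKey_advance_lt hlab hlci hq ho hcov hne
      rw [hkey] at hlt
      exact absurd (hp.target_le_succ hlab hlci hz hq' (by omega)
        ((List.mem_cons.1 hmem).resolve_left (by omega))) hlt.not_ge

/-- If the labels of the target arise from those of `x` by omission of the one at `j`, then the
moves are determined. -/
theorem MovePath.eq_range (hlab : IsEdgeLabelling lab) (hlci : IsLeastContentIncreasing lab)
    {m : ℕ} {z : ℕ → P} (hz : IsTarget lab m z) {x q : ℕ → P} {ops : List ℕ}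
    (h : MovePath lab m z q ops) (hq : IsState m q) (hx : ∀ i ≤ m, x i ⋖ x (i + 1)) {p : ℕ}
    (hpm : p ≤ m)
    (hkey : ∀ k, p ≤ k → k < m →
      key lab (z k) (z (k + 1)) = key lab (x (k + 1)) (x (k + 2)))
    (hqz : ∀ i ≤ p, q i = z i) (hqx : ∀ i, p < i → i ≤ m + 1 → q i = x i)
    (hne : p < m → x (p + 1) ≠ z (p + 1)) : ops = List.range' p (m - p) := by
  induction h generalizing p with
  | @done q h =>
    rcases hpm.eq_or_lt with rfl | hlt
    · simp
    · exact absurd ((hqx (p + 1) (by omega) (by omega)).symm.trans (h (p + 1) (by omega))) (hne hlt)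
  | @step q o ops ho hmove hcrit hp ih =>
    have hq' := hq.advance (lab := lab) hlci ho
    rcases Nat.lt_trichotomy o p with h1 | rfl | h1
    · exact (MovePath.false_of_move hlab hlci hz hq (by omega) hmove (hqz o h1.le)
        (hqz (o + 1) h1) hp).elim
    · rcases hpm.eq_or_lt with rfl | hlt
      · exact absurd ⟨rfl, hqz⟩ hcrit
      have hsk : stepKey lab q (o + 1) = key lab (z o) (z (o + 1)) := by
        have e1 := hqx (o + 1) (by omega) (by omega)
        have e2 := hqx (o + 1 + 1) (by omega) (by omega)
        rw [stepKey_of_covBy hlci (by rw [e1, e2]; exact hx _ (by omega)), e1, e2,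
          hkey o le_rfl hlt]
      have heq := le_antisymm ((stepKey_advance_le_succ hlab hlci hq hlt).trans_eq hsk)
        (hp.target_le hlab hlci hz hq' le_rfl hlt)
      have hfz : firstStep lab (q o) (q (o + 2)) = z (o + 1) := by
        rw [stepKey_advance_self hlci hq ho] at heq
        by_contra hne'
        have hcz := hz.covBy o (by omega)
        rw [← hqz o le_rfl] at hcz heq
        exact hlab.key_ne (firstStep_spec hlci (hq.lt_two ho)).1 hcz hne' heq
      have hqz' : ∀ i ≤ o + 1, advance lab q o i = z i := by
        intro i hi
        by_cases hi' : i = o + 1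
        · subst hi'
          rw [advance_self, hfz]
        · rw [advance_of_ne hi', hqz i (by omega)]
      have hqx' : ∀ i, o + 1 < i → i ≤ m + 1 → advance lab q o i = x i := fun i hi hi' => by
        rw [advance_of_ne (by omega), hqx i (by omega) hi']
      rw [ih hq' hlt (fun k h1 h2 => hkey k (by omega) h2) hqz' hqx' ?_,
        show m - o = (m - (o + 1)) + 1 by omega, List.range'_succ]
      intro hlt' hxz
      have e1 := hqz' o (by omega)
      have e2 := hqz' (o + 1) le_rfl
      have e3 : advance lab q o (o + 1 + 1) = z (o + 1 + 1) := by
        rw [hqx' (o + 1 + 1) (by omega) (by omega), hxz]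
      have hasc := stepKey_advance_ascent hlab hlci hq hlt
      rw [stepKey_of_covBy hlci (by rw [e1, e2]; exact hz.covBy o (by omega)),
        stepKey_of_covBy hlci (by rw [e3, e2]; exact hz.covBy (o + 1) (by omega)), e1, e2,
        e3] at hasc
      exact (hz.anti o (by omega)).not_ge hasc
    -- A move beyond `p` drops the label at `o` below the target label at `o - 1`. So position `o -
    -- 1` is never moved afterwards, which forces agreement with the target already at `p + 1`.
    · exfalso
      obtain ⟨n, rfl⟩ : ∃ n, o = n + 1 := ⟨o - 1, by omega⟩
      have e1 := hqx (n + 1) (by omega) (by omega)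
      have e2 := hqx (n + 1 + 1) (by omega) (by omega)
      have hlt := stepKey_advance_lt hlab hlci hq ho (by rw [e1, e2]; exact hx _ (by omega)) hmove
      rw [e1, e2, ← hkey n (by omega) (by omega)] at hlt
      by_cases hmem : n ∈ ops
      · exact hlt.not_ge (hp.target_le_succ hlab hlci hz hq' (by omega) hmem)
      · have := hp.eq_target_of_notMem hlab hlci hz hq' (by omega) hmem (p + 1) (by omega)
        rw [advance_of_ne (by omega), hqx (p + 1) (by omega) (by omega)] at this
        exact hne (by omega) this

end Moves

/-! ### Gradient paths as sequences of moves -/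

section Step

variable {P : Type*} [PartialOrder P] [BoundedOrder P] [DecidableEq P] {L : Type*}
  [LinearOrder L] {lab : P → P → Option L}

theorem IsNewFace.not_isSkipped {F : List P} {A K : Finset P} (hA : IsNewFace lab F A)
    (hK : ∀ t ∈ A, t ∉ K) : ¬ IsSkipped lab F K := by
  rintro ⟨-, F', hF', hlt, hsub⟩
  exact hA.2.2 F' hF' hlt fun t ht => hsub (Finset.mem_sdiff.2 ⟨hA.2.1 ht, hK t ht⟩)

theorem IsNewFace.not_key_lt (hlab : IsEdgeLabelling lab) (hlci : IsLeastContentIncreasing lab)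
    {F : List P} {A : Finset P} (hA : IsNewFace lab F A) {x y z q : P} (hx : x ∈ F) (hy : y ∈ F)
    (hq : q ∈ F) (hxy : x ⋖ y) (hxz : x ⋖ z) (hzq : z ≤ q) (hno : ∀ t ∈ A, x < t → ¬ t < q) :
    ¬ key lab x z < key lab x y := by
  classical
  intro hk
  have hF := isSatChain_iff.1 hA.1
  refine hA.not_isSkipped (K := (facet F).filter fun t => x < t ∧ t < q) ?_
    (isSkipped_of_key_lt hlab hlci hF hx hy hq hxy hxz hzq hk (Finset.filter_subset _ _) ?_)
  · intro t ht hK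
    rw [Finset.mem_filter] at hK
    exact hno t ht hK.2.1 hK.2.2
  · intro t ht h1 h2
    exact Finset.mem_filter.2 ⟨mem_facet.2 ⟨ht, (bot_le.trans_lt h1).ne',
      (h2.trans_le le_top).ne⟩, h1, h2⟩

variable [Finite P]

/-- Where the face leaves a gap, its facet must take the cover with the smallest label; any other
choice could be rerouted through an earlier facet. -/
theorem IsNewFace.firstStep_mem (hlab : IsEdgeLabelling lab)
    (hlci : IsLeastContentIncreasing lab) {F : List P} {A : Finset P} (hA : IsNewFace lab F A)
    {u q : P} (hu : u ∈ F) (hq : q ∈ F) (huq : u < q) (hno : ∀ t ∈ A, u < t → ¬ t < q) :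
    firstStep lab u q ∈ F := by
  have hF := isSatChain_iff.1 hA.1
  obtain ⟨y, hy, huy⟩ := hF.exists_next hu (huq.trans_le le_top).ne
  have hspec := firstStep_spec hlci huq
  by_contra hf
  have hyq := hF.ge_of_covBy hy huy hq huq
  have hne : firstStep lab u q ≠ y := by rintro h; exact hf (h ▸ hy)
  exact hA.not_key_lt hlab hlci hu hy hq huy hspec.1 hspec.2.1 hno
    ((hspec.2.2 y huy hyq).lt_of_ne (hlab.key_ne hspec.1 huy hne))

theorem IsNewFace.not_key_lt_of_agree (hlab : IsEdgeLabelling lab)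
    (hlci : IsLeastContentIncreasing lab) {F G : List P} {A : Finset P} (hA : IsNewFace lab F A)
    (hG : SatC ⊥ ⊤ G) {x y z u : P} (hx : x ∈ F) (hy : y ∈ F)
    (hz : z ∈ G) (hxy : x ⋖ y) (hxz : x ⋖ z) (hu : u ∈ F) (hu' : u ∈ G) (hxu : x < u)
    (hAG : ∀ t ∈ A, t < u → t ∈ G) : ¬ key lab x z < key lab x y := by
  obtain ⟨q, ⟨hqF, hqG, hxq⟩, hmin⟩ := Set.Finite.exists_minimal
    (s := {t | t ∈ F ∧ t ∈ G ∧ x < t}) (Set.toFinite _) ⟨u, hu, hu', hxu⟩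
  have hF := isSatChain_iff.1 hA.1
  have hqu : q ≤ u := by
    rcases hF.total hqF hu with h | h
    · exact h
    · exact hmin ⟨hu, hu', hxu⟩ h
  refine hA.not_key_lt hlab hlci hx hy hqF hxy hxz (hG.ge_of_covBy hz hxz hqG hxq) ?_
  intro t ht h1 h2
  exact h2.not_ge (hmin ⟨(mem_facet.1 (hA.2.1 ht)).1, hAG t ht (h2.trans_le hqu), h1⟩ h2.le)

/-- Below a common element, the facet of a new face depends only on the part of the face there. -/
theorem IsNewFace.agree (hlab : IsEdgeLabelling lab)
    (hlci : IsLeastContentIncreasing lab) {F F' : List P} {A A' : Finset P}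
    (hA : IsNewFace lab F A) (hA' : IsNewFace lab F' A') {u : P} (hu : u ∈ F) (hu' : u ∈ F')
    (hAA : ∀ t < u, t ∈ A ↔ t ∈ A') : ∀ t ≤ u, t ∈ F ↔ t ∈ F' := by
  have hF := isSatChain_iff.1 hA.1
  have hF' := isSatChain_iff.1 hA'.1
  obtain ⟨d, _, hd, _, _, hdm, _⟩ := hF.split lab hu
  obtain ⟨d', _, hd', _, _, hdm', _⟩ := hF'.split lab hu'
  have hdd : d = d' := by
    by_contra hne
    obtain ⟨x, y, z, hx, hx', hy, hz, hxy, hxz, hyz, -⟩ := hd.exists_diverge hd' hne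
    rw [hdm] at hx hy
    rw [hdm'] at hx' hz
    have hxu := hxy.lt.trans_le hy.2
    -- Whichever chain has the smaller label at the divergence shows that the face of the other one
    -- is not new.
    rcases (hlab.key_ne hxy hxz hyz).lt_or_gt with h | h
    · exact hA'.not_key_lt_of_agree hlab hlci hF hx'.1 hz.1 hy.1 hxz hxy hu' hu hxu
        (fun t ht h => (mem_facet.1 (hA.2.1 ((hAA t h).2 ht))).1) h
    · exact hA.not_key_lt_of_agree hlab hlci hF' hx.1 hy.1 hz.1 hxy hxz hu hu' hxu
        (fun t ht h => (mem_facet.1 (hA'.2.1 ((hAA t h).1 ht))).1) h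
  intro t ht
  have h1 := hdm t
  rw [hdd, hdm'] at h1
  exact ⟨fun h => (h1.2 ⟨h, ht⟩).1, fun h => (h1.1 ⟨h, ht⟩).1⟩

/-- `B` is a new face of `F` that contains the lowest element of `F` which is not a skipped
singleton. -/
def IsPivoted (lab : P → P → Option L) (F : List P) (B : Finset P) : Prop :=
  IsNewFace lab F B ∧ ∀ y ∈ facet F, y ∉ B → ∃ v ∈ B, v < y ∧ ¬ IsSkipped lab F {v}

/-- A matching step after the deletion of an element `e` inserts the first element of the
lexicographically smallest chain between the neighbours `u` and `q` of `e`. -/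
theorem IsPivoted.step (hlab : IsEdgeLabelling lab)
    (hlci : IsLeastContentIncreasing lab) (hCL : ∀ x : P, x ≠ ⊤ → IsCLLabellingBelow lab x)
    {F : List P} {B B' : Finset P} (hB : IsPivoted lab F B) {u e q : P} (hu : u = ⊥ ∨ u ∈ B)
    (hq : q = ⊤ ∨ q ∈ B) (hue : u < e) (heq : e < q) (hnbr : ∀ t ∈ B, t ≤ u ∨ t = e ∨ q ≤ t)
    (hm : lexMatching lab (B.erase e) B') :
    B' = insert (firstStep lab u q) (B.erase e) ∧ ∃ F', IsPivoted lab F' B' := by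
  obtain ⟨F', v, hnew, hpiv, hv, rfl⟩ := hm
  obtain ⟨⟨hvF, hvs⟩, hleast⟩ := hpiv.isLeast hlab hlci hCL hnew hv
  have hF := isSatChain_iff.1 hB.1.1
  have hF' := isSatChain_iff.1 hnew.1
  have huq := hue.trans heq
  have hmem : ∀ t ∈ B.erase e, t ∈ F' := fun t ht => (mem_facet.1 (hnew.2.1 ht)).1
  have hmemF : ∀ t ∈ B, t ∈ F := fun t ht => (mem_facet.1 (hB.1.2.1 ht)).1
  have huF' : u ∈ F' := by
    rcases hu with rfl | hu
    · exact hF'.left_mem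
    · exact hmem u (Finset.mem_erase.2 ⟨hue.ne, hu⟩)
  have huF : u ∈ F := by
    rcases hu with rfl | hu
    · exact hF.left_mem
    · exact hmemF u hu
  have hqF' : q ∈ F' := by
    rcases hq with rfl | hq
    · exact hF'.right_mem
    · exact hmem q (Finset.mem_erase.2 ⟨heq.ne', hq⟩)
  have hno : ∀ t ∈ B.erase e, u < t → ¬ t < q := by
    intro t ht h1 h2
    rw [Finset.mem_erase] at ht
    rcases hnbr t ht.2 with h | h | h
    · exact h1.not_ge h
    · exact ht.1 h
    · exact h2.not_ge h
  obtain ⟨hcov, hle, -⟩ := firstStep_spec hlci huq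
  have hlt : firstStep lab u q < q := hle.lt_of_ne fun h => (h ▸ hcov).2 hue heq
  have hfF' := hnew.firstStep_mem hlab hlci huF' hqF' huq hno
  have hffac : firstStep lab u q ∈ facet F' :=
    mem_facet.2 ⟨hfF', (bot_le.trans_lt hcov.lt).ne', (hlt.trans_le le_top).ne⟩
  have hns : ∀ {y}, y ∉ B.erase e → ¬ IsSkipped lab F' {y} := fun hy h =>
    hy (mem_of_isSkipped_singleton hnew h)
  have hvle : v ≤ firstStep lab u q :=
    hleast ⟨hffac, hns fun h => hno _ h hcov.lt hlt⟩
  have hvF'm := (mem_facet.1 hvF).1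
  have hveq : v = firstStep lab u q := by
    -- If `v` were lower, it would lie below `u`, where `F` and `F'` agree. As `v ∉ B`, the
    -- invariant supplies some `w < v` in `B` not skipped on its own in `F`, hence not in `F'` by
    -- locality; this contradicts the minimality of `v`.
    by_contra hne
    have hvu : v ≤ u := hF'.le_of_covBy huF' hcov hvF'm (hvle.lt_of_ne hne)
    have hvne : v ≠ u := by
      rintro rfl
      rcases hu with rfl | hu
      · exact (mem_facet.1 hvF).2.1 rfl
      · exact hv (Finset.mem_erase.2 ⟨hue.ne, hu⟩)
    have hvlt := hvu.lt_of_ne hvne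
    have hag := hB.1.agree hlab hlci hnew huF huF' fun t ht => by
      rw [Finset.mem_erase]
      exact ⟨fun h => ⟨(ht.trans hue).ne, h⟩, fun h => h.2⟩
    have hvB : v ∉ B := fun h => hv (Finset.mem_erase.2 ⟨(hvlt.trans hue).ne, h⟩)
    obtain ⟨w, hwB, hwv, hws⟩ :=
      hB.2 v (mem_facet.2 ⟨(hag v hvu).2 hvF'm, (mem_facet.1 hvF).2⟩) hvB
    have hwfac := mem_facet.1 (hB.1.2.1 hwB)
    obtain ⟨x, hx, hxw⟩ := hF.exists_prev hwfac.1 hwfac.2.1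
    obtain ⟨t, ht, hwt⟩ := hF.exists_next hwfac.1 hwfac.2.2
    have htv : t ≤ v := hF.ge_of_covBy ht hwt ((hag v hvu).2 hvF'm) hwv
    have hwu : w ≤ u := hwv.le.trans hvu
    have hwF' := (hag w hwu).1 hwfac.1
    rw [isSkipped_singleton_iff hlab hlci hF hx hwfac.1 ht hxw hwt,
      ← isSkipped_singleton_iff hlab hlci hF' ((hag x (hxw.le.trans hwu)).1 hx) hwF'
        ((hag t (htv.trans hvu)).1 ht) hxw hwt] at hws
    exact hwv.not_ge (hleast ⟨mem_facet.2 ⟨hwF', hwfac.2⟩, hws⟩)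
  refine ⟨by rw [hveq], F', ⟨hnew.1, ?_, ?_⟩, ?_⟩
  · exact Finset.insert_subset hvF hnew.2.1
  · exact fun G hG hlt hsub => hnew.2.2 G hG hlt ((Finset.subset_insert _ _).trans hsub)
  · intro y hy hyB
    rw [Finset.mem_insert, not_or] at hyB
    exact ⟨v, Finset.mem_insert_self _ _, (hleast ⟨hy, hns hyB.2⟩).lt_of_ne (Ne.symm hyB.1), hvs⟩

end Step

/-! ### From cells on a gradient path to moves -/

section Trace

variable {P : Type*} [PartialOrder P] [BoundedOrder P] [DecidableEq P] {L : Type*}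
  [LinearOrder L] {lab : P → P → Option L}

/-- The cell formed by the interior elements `q 1, …, q (m + 1)`. -/
def cellOf (m : ℕ) (q : ℕ → P) : Finset P := (Finset.range (m + 1)).image fun i => q (i + 1)

/-- The cells on the gradient path that performs the moves `ops` and ends in `σ`. -/
noncomputable def trace (lab : P → P → Option L) (m : ℕ) (σ : Finset P) :
    (ℕ → P) → List ℕ → List (Finset P)
  | q, [] => [cellOf m q, σ]
  | q, l :: ops =>
    cellOf m q :: (cellOf m q).erase (q (l + 1)) :: trace lab m σ (advance lab q l) ops

omit [PartialOrder P] [BoundedOrder P] in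
theorem mem_cellOf {m : ℕ} {q : ℕ → P} {y : P} : y ∈ cellOf m q ↔ ∃ i ≤ m, q (i + 1) = y := by
  simp [cellOf]

omit [DecidableEq P] in
theorem IsState.lt_of_lt {m : ℕ} {q : ℕ → P} (hq : IsState m q) {i j : ℕ} (hij : i < j)
    (hj : j ≤ m + 2) : q i < q j := by
  induction j, hij using Nat.le_induction with
  | base => exact hq.lt i (by omega)
  | succ j hij ih => exact (ih (by omega)).trans (hq.lt j (by omega))

omit [DecidableEq P] in
theorem IsState.le_of_le {m : ℕ} {q : ℕ → P} (hq : IsState m q) {i j : ℕ} (hij : i ≤ j)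
    (hj : j ≤ m + 2) : q i ≤ q j := by
  rcases hij.eq_or_lt with rfl | h
  · rfl
  · exact (hq.lt_of_lt h hj).le

omit [DecidableEq P] in
theorem IsState.injOn {m : ℕ} {q : ℕ → P} (hq : IsState m q) {i j : ℕ} (hi : i ≤ m + 2)
    (hj : j ≤ m + 2) (h : q i = q j) : i = j := by
  rcases Nat.lt_trichotomy i j with h1 | h1 | h1
  · exact absurd h (hq.lt_of_lt h1 hj).ne
  · exact h1
  · exact absurd h (hq.lt_of_lt h1 hi).ne'

theorem IsState.cellOf_advance {m : ℕ} {q : ℕ → P} (hq : IsState m q) {l : ℕ} (hl : l ≤ m) :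
    cellOf m (LexMorse.advance lab q l) =
      insert (firstStep lab (q l) (q (l + 2))) ((cellOf m q).erase (q (l + 1))) := by
  ext y
  rw [mem_cellOf, Finset.mem_insert, Finset.mem_erase, mem_cellOf]
  constructor
  · rintro ⟨i, hi, rfl⟩
    by_cases h : i = l
    · subst h
      exact .inl (advance_self q i)
    · rw [advance_of_ne (by omega)]
      exact .inr ⟨fun h' => h (by have := hq.injOn (by omega) (by omega) h'; omega), i, hi, rfl⟩
  · rintro (rfl | ⟨hne, i, hi, rfl⟩)
    · exact ⟨l, hl, advance_self q l⟩
    · refine ⟨i, hi, advance_of_ne ?_⟩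
      rintro h
      exact hne (by rw [h])

theorem IsState.eq_target {m : ℕ} {q z : ℕ → P} (hq : IsState m q) (hz : IsTarget lab m z)
    (hsub : ∀ i < m, z (i + 1) ∈ cellOf m q) : ∀ i ≤ m, q i = z i := by
  intro i hi
  induction i with
  | zero => rw [hq.bot, hz.bot]
  | succ i ih =>
    have ih := ih (by omega)
    obtain ⟨j, hj, hjz⟩ := mem_cellOf.1 (hsub i hi)
    have hc := hz.covBy i hi
    rw [← ih, ← hjz] at hc
    rcases Nat.lt_trichotomy i j with h | rfl | h
    · exact (hc.2 (hq.lt i (by omega)) (hq.lt_of_lt (by omega) (by omega))).elim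
    · exact hjz
    · exact absurd hc.lt (hq.le_of_le (by omega) (by omega)).not_gt

variable [Finite P]

omit [DecidableEq P] in
theorem MovePath.runMoves_spec (hlci : IsLeastContentIncreasing lab) {m : ℕ} {q z : ℕ → P}
    {ops : List ℕ} (h : MovePath lab m z q ops) (hq : IsState m q) :
    IsState m (runMoves lab q ops) ∧ ∀ i ≤ m, runMoves lab q ops i = z i := by
  induction h with
  | done h => exact ⟨hq, h⟩
  | step ho _ _ _ ih => exact ih (hq.advance hlci ho)

theorem IsGradientPath.exists_movePath (hlab : IsEdgeLabelling lab)
    (hlci : IsLeastContentIncreasing lab) (hCL : ∀ x : P, x ≠ ⊤ → IsCLLabellingBelow lab x)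
    {m : ℕ} {q z : ℕ → P} (hq : IsState m q) (hz : IsTarget lab m z) {F : List P}
    (hF : IsPivoted lab F (cellOf m q)) {σ : Finset P}
    (hσ : ∀ y, y ∈ σ ↔ ∃ i < m, z (i + 1) = y) (hcrit : ∀ B, ¬ lexMatching lab σ B)
    {l : List (Finset P)} (h : IsGradientPath (lexMatching lab) (cellOf m q) σ l) :
    ∃ ops, MovePath lab m z q ops ∧ l = trace lab m σ q ops := by
  generalize hτ : cellOf m q = τ at h hF
  induction h generalizing q F with
  | @last τ σ hcov _ =>
    subst hτ
    exact ⟨[], .done (hq.eq_target hz fun i hi => hcov.le ((hσ _).2 ⟨i, hi, rfl⟩)), rfl⟩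
  | @step τ ρ τ' σ l hcov hnm hm _ ih =>
    subst hτ
    obtain ⟨e, he, rfl⟩ := Finset.covBy_iff_exists_erase.1 hcov
    obtain ⟨o, ho, rfl⟩ := mem_cellOf.1 he
    have hu : q o = ⊥ ∨ q o ∈ cellOf m q := by
      cases o with
      | zero => exact .inl hq.bot
      | succ o => exact .inr (mem_cellOf.2 ⟨o, by omega, rfl⟩)
    have hv : q (o + 2) = ⊤ ∨ q (o + 2) ∈ cellOf m q := by
      rcases ho.eq_or_lt with rfl | h
      · exact .inl hq.top
      · exact .inr (mem_cellOf.2 ⟨o + 1, by omega, rfl⟩)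
    have hnbr : ∀ t ∈ cellOf m q, t ≤ q o ∨ t = q (o + 1) ∨ q (o + 2) ≤ t := by
      intro t ht
      obtain ⟨i, hi, rfl⟩ := mem_cellOf.1 ht
      rcases Nat.lt_trichotomy i o with h | rfl | h
      · exact .inl (hq.le_of_le (by omega) (by omega))
      · exact .inr (.inl rfl)
      · exact .inr (.inr (hq.le_of_le (by omega) (by omega)))
    obtain ⟨hτ', F', hF'⟩ := hF.step hlab hlci hCL hu hv (hq.lt o (by omega))
      (hq.lt (o + 1) (by omega)) hnbr hm
    have hcell := hq.cellOf_advance (lab := lab) ho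
    rw [← hτ'] at hcell
    obtain ⟨ops, hops, rfl⟩ := ih (hq.advance hlci ho) hσ hcrit hcell hF'
    refine ⟨o :: ops, .step ho ?_ ?_ hops, rfl⟩
    -- Reinserting the deleted element would mean that the downward step ran along a matching edge.
    · intro h
      rw [h, Finset.insert_erase he] at hτ'
      exact hnm (hτ' ▸ hm)
    -- The lower cell would be `σ` itself, which is critical and cannot be matched upwards.
    · rintro ⟨rfl, heq⟩
      refine hcrit τ' ?_
      convert hm
      ext y
      rw [hσ, Finset.mem_erase, mem_cellOf]
      constructor
      · rintro ⟨i, hi, rfl⟩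
        rw [← heq (i + 1) hi]
        exact ⟨(hq.lt_of_lt (by omega) (by omega)).ne, i, hi.le, rfl⟩
      · rintro ⟨hne, i, hi, rfl⟩
        have : i ≠ o := by rintro rfl; exact hne rfl
        exact ⟨i, by omega, (heq (i + 1) (by omega)).symm⟩

omit [Finite P] in
/-- A gradient path lowers the number of elements by one. -/
theorem IsGradientPath.card_eq {τ σ : Finset P} {l : List (Finset P)}
    (h : IsGradientPath (lexMatching lab) τ σ l) : σ.card + 1 = τ.card := by
  induction h with
  | last hcov _ => exact Nat.covBy_iff_add_one_eq.1 hcov.card_finset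
  | @step τ ρ τ' σ l hcov _ hm _ ih =>
    have h1 : ρ.card + 1 = τ.card := Nat.covBy_iff_add_one_eq.1 hcov.card_finset
    obtain ⟨_, v, -, -, hv, rfl⟩ := hm
    rw [Finset.card_insert_of_notMem hv] at ih
    omega

end Trace

/-! ### Critical cells of chains whose labels decrease at first -/

section Prefix

variable {P : Type*} [PartialOrder P] [BoundedOrder P] {L : Type*} {lab : P → P → Option L}

omit [BoundedOrder P] in
theorem SatC.exists_cons {u v : P} {c : List P} (h : SatC u v c) (hne : u ≠ v) :
    ∃ y d, c = u :: d ∧ u ⋖ y ∧ SatC y v d := by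
  cases h with
  | single => exact absurd rfl hne
  | cons h1 h2 => exact ⟨_, _, rfl, h1, h2⟩

theorem SatC.exists_prefix (hlab : IsEdgeLabelling lab) {u : P} {c : List P} (h : SatC u ⊤ c)
    {k : ℕ} (hk : k ≤ (labelSeq lab c).length) :
    ∃ (x : ℕ → P) (e : List P), x 0 = u ∧
      (∀ i < k, x i ⋖ x (i + 1) ∧ lab (x i) (x (i + 1)) = (labelSeq lab c)[i]?) ∧
      (∀ i ≤ k, x i ∈ c) ∧ SatC (x k) ⊤ e ∧ labelSeq lab e = (labelSeq lab c).drop k ∧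
      (∀ t ∈ e, t ∈ c) ∧ ∀ t ∈ c, (∃ i < k, x i = t) ∨ t ∈ e := by
  induction k generalizing u c with
  | zero =>
    exact ⟨fun _ => u, c, rfl, by simp, fun _ _ => h.left_mem, h, by simp, fun _ => id,
      fun t ht => .inr ht⟩
  | succ k ih =>
    cases h with
    | single => simp [labelSeq] at hk
    | @cons _ y _ c h1 h2 =>
      -- Only a cover of `⊤` can be unlabelled; if the first step were such a cover, no label would
      -- remain, against `hk`.
      have hy : ∃ b, lab u y = some b := by
        by_cases hy : y = ⊤
        · subst hy
          have : c = [⊤] := by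
            cases h2 with
            | single => rfl
            | cons h3 h4 => exact absurd h3.lt not_top_lt
          rw [h2.labelSeq_cons, this] at hk
          cases hb : lab u ⊤ with
          | none => simp [hb, labelSeq] at hk
          | some b => exact ⟨b, rfl⟩
        · exact hlab.exists_label h1 hy
      obtain ⟨b, hb⟩ := hy
      have hls : labelSeq lab (u :: c) = b :: labelSeq lab c := by
        rw [h2.labelSeq_cons, hb]; rfl
      rw [hls, List.length_cons] at hk
      obtain ⟨x, e, hx0, hx, hxc, he, hel, hec, hcov⟩ := ih h2 (by omega)
      refine ⟨fun i => Nat.casesOn i u x, e, rfl, ?_, ?_, he, by simp [hls, hel],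
        fun t ht => by simp [hec t ht], ?_⟩
      · rintro (_ | i) hi
        · simp [hx0, h1, hb, hls]
        · simpa [hls] using hx i (by omega)
      · rintro (_ | i) hi
        · simp
        · simp [hxc i (by omega)]
      · intro t ht
        rcases List.mem_cons.1 ht with rfl | ht
        · exact .inl ⟨0, by omega, rfl⟩
        · rcases hcov t ht with ⟨i, hi, rfl⟩ | h
          · exact .inl ⟨i + 1, by omega, rfl⟩
          · exact .inr h

variable [DecidableEq P] [LinearOrder L] [Finite P]

/-- The elements up to the first ascent belong to the critical cell. -/
theorem Contributes.prefix_mem (hlab : IsEdgeLabelling lab)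
    (hlci : IsLeastContentIncreasing lab) (hCL : ∀ x : P, x ≠ ⊤ → IsCLLabellingBelow lab x)
    {F : List P} {A : Finset P} (hA : Contributes lab F A) {m : ℕ} {x : ℕ → P} {e : List P}
    (hx0 : x 0 = ⊥) (hx : ∀ i ≤ m, x i ⋖ x (i + 1)) (hxF : ∀ i ≤ m + 1, x i ∈ F)
    (htop : x (m + 1) ≠ ⊤) (he : SatC (x (m + 1)) ⊤ e)
    (hcov : ∀ t ∈ F, (∃ i < m + 1, x i = t) ∨ t ∈ e)
    (hanti : ∀ i < m, key lab (x (i + 1)) (x (i + 2)) < key lab (x i) (x (i + 1))) :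
    ∀ i ≤ m, x (i + 1) ∈ A := by
  have hF := isSatChain_iff.1 hA.1.1
  have hle : ∀ i ≤ m + 1, x i ≤ x (m + 1) := fun i hi => by
    induction hi using Nat.decreasingInduction with
    | self => rfl
    | of_succ i hi ih => exact (hx i (by omega)).le.trans ih
  have hsk : ∀ i < m, IsSkipped lab F {x (i + 1)} := fun i hi =>
    isSkipped_of_descent hlab hlci hF (hxF i (by omega)) (hxF (i + 1) (by omega))
      (hxF (i + 2) (by omega)) (hx i hi.le) (hx (i + 1) hi)
      (ne_top_of_le_ne_top htop (hle _ (by omega))) (hanti i hi)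
  intro i hi
  rcases hi.eq_or_lt with rfl | hi
  · have hfac : x (i + 1) ∈ facet F := mem_facet.2
      ⟨hxF _ le_rfl, (bot_le.trans_lt (hx i le_rfl).lt).ne', htop⟩
    refine (((hA.mem_iff hlab hlci hCL).1 _ hfac).2 (.inr ?_))
    intro v hv hvs
    rcases hcov v (mem_facet.1 hv).1 with ⟨j, hj, rfl⟩ | hve
    · cases j with
      | zero => exact absurd hx0 (mem_facet.1 hv).2.1
      | succ j => exact absurd (hsk j (by omega)) hvs
    · exact (he.mem_bounds hve).1
  · exact mem_of_isSkipped_singleton hA.1 (hsk i hi)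

theorem not_isSkipped_of_next (hlab : IsEdgeLabelling lab)
    (hlci : IsLeastContentIncreasing lab) (hCL : ∀ x : P, x ≠ ⊤ → IsCLLabellingBelow lab x)
    {F : List P} (hF : SatC ⊥ ⊤ F) {x y : P} (hx : x ∈ F) (hy : y ∈ F) (hxy : x ⋖ y)
    (hasc : ∀ s ∈ F, y ⋖ s → s ≠ ⊤ → key lab x y ≤ key lab y s) {t : P} (ht : t ∈ facet F)
    (hyt : y < t) : ¬ IsSkipped lab F {y} := by
  obtain ⟨s, hs, hys⟩ := hF.exists_next hy (hyt.trans_le le_top).ne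
  have htop : s ≠ ⊤ := ne_top_of_le_ne_top (mem_facet.1 ht).2.2
    (hF.ge_of_covBy hs hys (mem_facet.1 ht).1 hyt)
  exact not_isSkipped_of_ascent hlab hlci hCL hF hx hy hs hxy hys htop (hasc s hs hys htop)

end Prefix

/-! ### Critical cells as bottom segments of chains -/

section Data

variable {P : Type*} [PartialOrder P] [BoundedOrder P] [DecidableEq P] {L : Type*}
  [LinearOrder L]

/-- The chain `F` has the elements `x 0, …, x (m + 1)` at the bottom, with labels `ls`, and
contributes the critical cell `x 1, …, x (m + 1)`. -/
structure IsInitialData (lab : P → P → Option L) (F : List P) (A : Finset P) (m : ℕ)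
    (ls rs : List L) (x : ℕ → P) : Prop where
  state : IsState m x
  covBy : ∀ i ≤ m, x i ⋖ x (i + 1)
  key_eq : ∀ i ≤ m, ∃ h : i < ls.length, key lab (x i) (x (i + 1)) = (ls[i] : WithBot L)
  mem : ∀ i ≤ m + 1, x i ∈ F
  cell : cellOf m x = A
  pivoted : IsPivoted lab F A
  rest : ∃ e, SatC (x (m + 1)) ⊤ e ∧ labelSeq lab e = rs ∧ ∀ t ∈ e, t ∈ F

variable [Finite P] {lab : P → P → Option L}

theorem Contributes.exists_initialData (hlab : IsEdgeLabelling lab)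
    (hlci : IsLeastContentIncreasing lab) (hCL : ∀ x : P, x ≠ ⊤ → IsCLLabellingBelow lab x)
    {F : List P} {A : Finset P} (hA : Contributes lab F A) {m : ℕ} {ls rs : List L}
    (htop : (∀ x : P, x ⋖ ⊤ → lab x ⊤ = none) ∨ rs ≠ []) (hlen : ls.length = m + 1)
    (hls : ls.Pairwise (· > ·)) (hseq : labelSeq lab F = ls ++ rs)
    (hrs : ∀ (h : m < ls.length), ∀ b ∈ rs, ls[m] ≤ b) :
    ∃ x, IsInitialData lab F A m ls rs x := by
  have hF := isSatChain_iff.1 hA.1.1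
  obtain ⟨x, e, hx0, hx, hxF, he, hel, heF, hcov⟩ := hF.exists_prefix hlab (k := m + 1)
    (by simp [hseq, hlen])
  have hlab' : ∀ i ≤ m, ∃ h : i < ls.length, key lab (x i) (x (i + 1)) = (ls[i] : WithBot L) := by
    intro i hi
    have h : i < ls.length := by omega
    refine ⟨h, ?_⟩
    rw [key_eq_coe, (hx i (by omega)).2, hseq, List.getElem?_append_left h, List.getElem?_eq_getElem]
  have hcovBy : ∀ i ≤ m, x i ⋖ x (i + 1) := fun i hi => (hx i (by omega)).1
  have hanti : ∀ i < m, key lab (x (i + 1)) (x (i + 2)) < key lab (x i) (x (i + 1)) := by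
    intro i hi
    obtain ⟨h1, e1⟩ := hlab' i hi.le
    obtain ⟨h2, e2⟩ := hlab' (i + 1) hi
    rw [e1, e2, WithBot.coe_lt_coe]
    exact List.pairwise_iff_getElem.1 hls i (i + 1) h1 h2 (Nat.lt_succ_self i)
  have hel' : labelSeq lab e = rs := by rw [hel, hseq, List.drop_left' hlen]
  -- The label at index `m` would belong to a cover of `⊤`, which is impossible if those are
  -- unlabelled; and if `rs` is nonempty, there are still labels above `x (m + 1)`.
  have hne : x (m + 1) ≠ ⊤ := by
    intro h
    rcases htop with htop | hrs'
    · obtain ⟨h1, e1⟩ := hlab' m le_rfl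
      have := hcovBy m le_rfl
      rw [h] at e1 this
      rw [key_eq_coe, htop _ this] at e1
      simp at e1
    · rw [h] at he
      rw [← hel', he.eq_of_le (.single ⊤) fun t ht => by simpa using (he.mem_bounds ht).1] at hrs'
      exact hrs' rfl
  have hmemA := hA.prefix_mem hlab hlci hCL hx0 hcovBy hxF hne he hcov hanti
  have hns : ∀ t ∈ facet F, x (m + 1) < t → ¬ IsSkipped lab F {x (m + 1)} := by
    intro t ht hlt
    refine not_isSkipped_of_next hlab hlci hCL hF (hxF m (by omega)) (hxF _ le_rfl)
      (hcovBy m le_rfl) ?_ ht hlt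
    intro s hs hys hst
    obtain ⟨h1, e1⟩ := hlab' m le_rfl
    obtain ⟨b, hb⟩ := hlab.exists_label hys hst
    rw [e1, key_eq_coe.2 hb, WithBot.coe_le_coe]
    refine hrs h1 b ?_
    rw [← hel']
    obtain ⟨s', e', rfl, h2, h3⟩ := he.exists_cons hne
    obtain rfl := hF.unique_next hs (heF s' (by simp [h3.left_mem])) hys h2
    simp [h3.labelSeq_cons, hb]
  have hgt : ∀ t ∈ facet F, t ∉ A → x (m + 1) < t := by
    intro t ht htA
    rcases hcov t (mem_facet.1 ht).1 with ⟨i, hi, rfl⟩ | hte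
    · cases i with
      | zero => exact absurd hx0 (mem_facet.1 ht).2.1
      | succ i => exact absurd (hmemA i (by omega)) htA
    · refine (he.mem_bounds hte).1.lt_of_ne ?_
      rintro rfl
      exact htA (hmemA m le_rfl)
  have hAle : ∀ t ∈ A, ∃ i ≤ m, x (i + 1) = t := by
    intro t htA
    have ht := hA.1.2.1 htA
    rcases hcov t (mem_facet.1 ht).1 with ⟨i, hi, rfl⟩ | hte
    · cases i with
      | zero => exact absurd hx0 (mem_facet.1 ht).2.1
      | succ i => exact ⟨i, by omega, rfl⟩
    · rcases (he.mem_bounds hte).1.eq_or_lt with h | h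
      · exact ⟨m, le_rfl, h⟩
      · exfalso
        have hfac := hA.1.2.1 (hmemA m le_rfl)
        have hspec := hA.mem_iff hlab hlci hCL
        have h1 := hns t ht h
        rcases (hspec.1 t ht).1 htA with h2 | h2
        · exact hspec.2 _ hfac t ht h1 h.le h2
        · exact h.not_ge (h2 _ hfac h1)
  -- A state has its top at index `m + 2`, so the sequence is continued by `⊤` beyond the prefix.
  let y : ℕ → P := fun i => if i ≤ m + 1 then x i else ⊤
  have hy : ∀ i ≤ m + 1, y i = x i := fun i hi => if_pos hi
  refine ⟨y, ⟨?_, ?_, ?_⟩, ?_, ?_, ?_, ?_, ⟨hA.1, ?_⟩, ?_⟩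
  · rw [hy 0 (by omega), hx0]
  · exact if_neg (by omega)
  · intro i hi
    rw [hy i (by omega)]
    rcases (show i ≤ m + 1 by omega).eq_or_lt with rfl | h
    · rw [show y (m + 1 + 1) = ⊤ from if_neg (by omega)]
      exact lt_top_iff_ne_top.2 hne
    · rw [hy (i + 1) (by omega)]
      exact (hcovBy i (by omega)).lt
  · intro i hi
    rw [hy i (by omega), hy (i + 1) (by omega)]
    exact hcovBy i hi
  · intro i hi
    rw [hy i (by omega), hy (i + 1) (by omega)]
    exact hlab' i hi
  · intro i hi
    rw [hy i hi]
    exact hxF i hi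
  · ext t
    rw [mem_cellOf]
    constructor
    · rintro ⟨i, hi, rfl⟩
      rw [hy (i + 1) (by omega)]
      exact hmemA i hi
    · intro ht
      obtain ⟨i, hi, rfl⟩ := hAle t ht
      exact ⟨i, hi, hy (i + 1) (by omega)⟩
  · intro t ht htA
    exact ⟨_, hmemA m le_rfl, hgt t ht htA, hns t ht (hgt t ht htA)⟩
  · rw [hy (m + 1) le_rfl]
    exact ⟨e, he, hel', heF⟩

omit [Finite P] in
theorem IsInitialData.isTarget {F : List P} {A : Finset P} {m : ℕ} {ls rs : List L} {x : ℕ → P}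
    (h : IsInitialData lab F A m ls rs x) (hls : ls.Pairwise (· > ·)) :
    IsTarget lab (m + 1) x := by
  refine ⟨h.state.bot, fun i hi => h.covBy i (by omega), fun i hi => ?_⟩
  obtain ⟨h1, e1⟩ := h.key_eq i (by omega)
  obtain ⟨h2, e2⟩ := h.key_eq (i + 1) (by omega)
  rw [e1, e2, WithBot.coe_lt_coe]
  exact List.pairwise_iff_getElem.1 hls i (i + 1) h1 h2 (Nat.lt_succ_self i)

omit [Finite P] in
theorem IsInitialData.card {F : List P} {A : Finset P} {m : ℕ} {ls rs : List L} {x : ℕ → P}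
    (h : IsInitialData lab F A m ls rs x) : A.card = m + 1 := by
  rw [← h.cell, cellOf, Finset.card_image_of_injOn, Finset.card_range]
  intro i hi j hj hij
  simp only [Finset.coe_range, Set.mem_Iio] at hi hj
  have := h.state.injOn (by omega) (by omega) hij
  omega

omit [Finite P] in
/-- The top part of the chain has the lexicographically smallest label sequence. -/
theorem IsInitialData.rest_le (hlab : IsEdgeLabelling lab)
    (hlci : IsLeastContentIncreasing lab) {F : List P} {A : Finset P} {m : ℕ} {ls rs : List L}
    {x : ℕ → P} (h : IsInitialData lab F A m ls rs x) {c : List P}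
    (hc : SatC (x (m + 1)) ⊤ c) :
    rs ≤ (labelSeq lab c).mergeSort (fun x y => decide (x ≤ y)) := by
  obtain ⟨e, he, rfl, heF⟩ := h.rest
  refine hlci.2 _ _ e c ⟨isSatChain_iff.2 he, fun c' hc' => ?_⟩ (isSatChain_iff.2 hc)
  rw [isSatChain_iff] at hc'
  by_contra hlt
  obtain ⟨p, y, z, hp, hp', hy, hz, hpy, hpz, -, hk⟩ := hlab.exists_key_lt hc' he (not_le.1 hlt)
  refine h.pivoted.1.not_key_lt hlab hlci (heF p hp') (heF z hz)
    (isSatChain_iff.1 h.pivoted.1.1).right_mem hpz hpy le_top ?_ hk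
  intro t ht hpt
  rw [← h.cell] at ht
  obtain ⟨i, hi, rfl⟩ := mem_cellOf.1 ht
  exact absurd ((he.mem_bounds hp').1.trans_lt hpt)
    (h.state.le_of_le (by omega) (by omega)).not_gt

end Data

/-! ### Sorted lists of labels -/

section Sorted

variable {L : Type*} [LinearOrder L]

/-- Common heads below `u` cancel. When they are used up, `A` continues with something larger than
`u` while `B` still has `u` to list, so `A` is the larger sequence. -/
theorem not_sorted_le {A B : List L} (hA : A.Pairwise (· < ·)) (hB : B.Pairwise (· ≤ ·))
    (hAB : A ≤ B) {u : L} (huB : u ∈ B) (huA : u ∉ A) (hlow : ∀ t ∈ A, t < u → t ∈ B)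
    (hup : ∃ w ∈ A, u < w) : False := by
  induction A generalizing B with
  | nil => simp at hup
  | cons a A ih =>
    cases B with
    | nil => simp at huB
    | cons b B =>
      rw [List.pairwise_cons] at hA hB
      have hbu : b ≤ u := by
        rcases List.mem_cons.1 huB with rfl | h
        · exact le_rfl
        · exact hB.1 u h
      have hab : a ≤ b := by
        by_contra h
        exact absurd hAB (not_le.2 (List.cons_lt_cons_iff.2 (.inl (not_le.1 h))))
      have hau : a < u := (hab.trans hbu).lt_of_ne (by rintro rfl; simp at huA)
      have hba : b ≤ a := by
        rcases List.mem_cons.1 (hlow a (by simp) hau) with rfl | h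
        · exact le_rfl
        · exact hB.1 a h
      obtain rfl := le_antisymm hab hba
      refine ih hA.2 hB.2 ?_ ((List.mem_cons.1 huB).resolve_left hau.ne') (by simp_all) ?_ ?_
      · by_contra h
        exact absurd hAB (not_le.2 (List.cons_lt_cons_iff.2 (.inr ⟨rfl, not_le.1 h⟩)))
      · intro t ht htu
        exact (List.mem_cons.1 (hlow t (by simp [ht]) htu)).resolve_left (hA.1 t ht).ne'
      · obtain ⟨w, hw, huw⟩ := hup
        exact ⟨w, (List.mem_cons.1 hw).resolve_left (hau.trans huw).ne', huw⟩

theorem le_card_filter_not_lt {s : List L} (hs : s.Pairwise (· > ·)) {k : ℕ} (hk : k < s.length)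
    {u : L} (hu : u ≤ s[k]) : k + 1 ≤ (s.toFinset.filter fun x => ¬ x < u).card := by
  have hnd : s.Nodup := hs.imp fun h => h.ne'
  have : (s.take (k + 1)).toFinset.card = k + 1 := by
    rw [List.toFinset_card_of_nodup (hnd.sublist (List.take_sublist _ _)), List.length_take]
    omega
  rw [← this]
  refine Finset.card_le_card fun x hx => ?_
  rw [List.mem_toFinset, List.mem_take_iff_getElem] at hx
  obtain ⟨i, hi, rfl⟩ := hx
  rw [Finset.mem_filter, List.mem_toFinset]
  refine ⟨List.getElem_mem _, not_lt.2 (hu.trans ?_)⟩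
  rcases (show i ≤ k by omega).eq_or_lt with rfl | h
  · exact le_rfl
  · exact (List.pairwise_iff_getElem.1 hs i k _ hk h).le

theorem card_filter_not_lt_le {s : List L} (hs : s.Pairwise (· > ·)) {k : ℕ} (hk : k < s.length) :
    (s.toFinset.filter fun x => ¬ x < s[k]).card ≤ k + 1 := by
  refine (Finset.card_le_card (t := (s.take (k + 1)).toFinset) fun x hx => ?_).trans
    ((List.toFinset_card_le _).trans (List.length_take_le _ _))
  rw [Finset.mem_filter, List.mem_toFinset] at hx
  obtain ⟨⟨i, hi, rfl⟩, hx⟩ := And.imp_left List.mem_iff_getElem.1 hx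
  rw [List.mem_toFinset, List.mem_take_iff_getElem]
  refine ⟨i, ?_, rfl⟩
  by_contra hik
  exact hx (List.pairwise_iff_getElem.1 hs k i hk hi (by omega))

theorem pairwise_sort_gt (S : Finset L) : (S.sort (· ≥ ·)).Pairwise (· > ·) :=
  S.sortedGT_sort.pairwise

/-- Let `u` be the least element of `U \ W`. Counting the elements at least `u` in the two
decreasing lists shows that every element of `W` below `u` lies in `U`. Then `W` skips `u` where `B`
does not, so sorted `W` would exceed `B`. -/
theorem subset_of_sort_le {S U W : Finset L} (hU : U ⊆ S)
    (hcard : W.card = U.card + 1) (hWS : W ⊆ S) {B : List L}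
    (hA : ∀ k (h : k < ((S \ W).sort (· ≥ ·)).length), ∃ h' : k + 1 < ((S \ U).sort (· ≥ ·)).length,
      ((S \ W).sort (· ≥ ·))[k] ≤ ((S \ U).sort (· ≥ ·))[k + 1] ∨
        ((S \ W).sort (· ≥ ·))[k] = ((S \ U).sort (· ≥ ·))[k])
    (hB : B.Pairwise (· ≤ ·)) (hUB : ∀ t ∈ U, t ∈ B) (hle : W.sort (· ≤ ·) ≤ B) : U ⊆ W := by
  by_contra hUW
  have hne : (U \ W).Nonempty := Finset.sdiff_nonempty.2 hUW
  obtain ⟨huU, huW⟩ := Finset.mem_sdiff.1 ((U \ W).min'_mem hne)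
  have hmin : ∀ t ∈ U, t ∉ W → (U \ W).min' hne ≤ t := fun t h1 h2 =>
    Finset.min'_le _ _ (Finset.mem_sdiff.2 ⟨h1, h2⟩)
  generalize (U \ W).min' hne = u at huU huW hmin
  have hlow : ∀ t ∈ W, t < u → t ∈ U := by
    intro t htW htu
    by_contra htU
    obtain ⟨k, hk, hku⟩ := List.mem_iff_getElem.1
      (show u ∈ (S \ W).sort (· ≥ ·) by simp [hU huU, huW])
    obtain ⟨hk', hor⟩ := hA k hk
    have hus : u ≤ ((S \ U).sort (· ≥ ·))[k + 1] := by
      rcases hor with h | h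
      · exact hku ▸ h
      · have : u ∈ (S \ U).sort (· ≥ ·) := by
          rw [← hku, h]; exact List.getElem_mem _
        simp [huU] at this
    have h1 := le_card_filter_not_lt (pairwise_sort_gt (S \ U)) hk' hus
    have h2 := card_filter_not_lt_le (pairwise_sort_gt (S \ W)) hk
    rw [hku] at h2
    rw [Finset.sort_toFinset] at h1 h2
    have h3 := Finset.card_filter_add_card_filter_not (s := S \ U) (fun x => x < u)
    have h4 := Finset.card_filter_add_card_filter_not (s := S \ W) (fun x => x < u)
    have h5 : ((S \ W).filter (· < u)).card < ((S \ U).filter (· < u)).card := by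
      refine Finset.card_lt_card (Finset.ssubset_iff.2 ⟨t, by simp [htW], ?_⟩)
      refine Finset.insert_subset (by simp [hWS htW, htU, htu]) fun x hx => ?_
      simp only [Finset.mem_filter, Finset.mem_sdiff] at hx ⊢
      exact ⟨⟨hx.1.1, fun h => hx.2.not_ge (hmin x h hx.1.2)⟩, hx.2⟩
    have h6 := Finset.card_sdiff_add_card_eq_card hU
    have h7 := Finset.card_sdiff_add_card_eq_card hWS
    omega
  refine not_sorted_le W.sortedLT_sort.pairwise hB hle (hUB u huU) (by simpa using huW)
    (fun t ht htu => hUB t (hlow t (by simpa using ht) htu)) ?_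
  by_contra hno
  push Not at hno
  have : W ⊆ U.erase u := by
    intro t ht
    have htu : t < u := (hno t (by simpa using ht)).lt_of_ne (by rintro rfl; exact huW ht)
    exact Finset.mem_erase.2 ⟨htu.ne, hlow t ht htu⟩
  have := Finset.card_le_card this
  rw [Finset.card_erase_of_mem huU] at this
  omega

theorem sort_erase_eq_eraseIdx (S : Finset L) (i : L) :
    (S.erase i).sort (· ≥ ·) = (S.sort (· ≥ ·)).eraseIdx ((S.sort (· ≥ ·)).idxOf i) := by
  rw [← List.erase_eq_eraseIdx_of_idxOf rfl]
  refine List.Perm.eq_of_pairwise' (r := (· ≥ ·)) (Finset.pairwise_sort _ _)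
    ((Finset.pairwise_sort _ _).sublist List.erase_sublist) ?_
  rw [List.perm_ext_iff_of_nodup (Finset.sort_nodup _ _)
    ((Finset.sort_nodup _ _).sublist List.erase_sublist)]
  intro t
  rw [(Finset.sort_nodup _ _).mem_erase_iff]
  simp

end Sorted

/-! ### Gradient paths between the critical cells indexed by sets of labels -/

section Edges

variable {P : Type*} [PartialOrder P] [BoundedOrder P] [DecidableEq P] [Finite P] {L : Type*}
  [LinearOrder L] {lab : P → P → Option L}

/-- The elements of `S \ U` in decreasing order, followed by `a`. -/
def headLabels (S U : Finset L) (a : L) : List L := (S \ U).sort (· ≥ ·) ++ [a]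

theorem length_headLabels (S U : Finset L) (a : L) :
    (headLabels S U a).length = (S \ U).card + 1 := by simp [headLabels]

theorem headLabels_pairwise {S : Finset L} (U : Finset L) {a : L} (ha : ∀ b ∈ S, a < b) :
    (headLabels S U a).Pairwise (· > ·) := by
  refine List.pairwise_append.2 ⟨pairwise_sort_gt _, List.pairwise_singleton _ _, ?_⟩
  intro x hx y hy
  obtain rfl := List.mem_singleton.1 hy
  exact ha x (by simp at hx; exact hx.1)

theorem headLabels_last (S U : Finset L) (a : L) (h : (S \ U).card < (headLabels S U a).length) :
    (headLabels S U a)[(S \ U).card] = a := by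
  simp [headLabels, List.getElem_append_right]

theorem headLabels_getElem {S U : Finset L} {a : L} {i : ℕ}
    (h : i < ((S \ U).sort (· ≥ ·)).length) (h' : i < (headLabels S U a).length) :
    (headLabels S U a)[i] = ((S \ U).sort (· ≥ ·))[i] := List.getElem_append_left h

theorem headLabels_insert {S U : Finset L} {a i : L} (hi : i ∈ S \ U) :
    ∃ j < (S \ U).card, headLabels S (insert i U) a = (headLabels S U a).eraseIdx j := by
  have hj : ((S \ U).sort (· ≥ ·)).idxOf i < ((S \ U).sort (· ≥ ·)).length :=
    List.idxOf_lt_length_of_mem (by simpa using hi)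
  refine ⟨_, by simpa using hj, ?_⟩
  rw [headLabels, headLabels, List.eraseIdx_append_of_lt_length hj,
    ← sort_erase_eq_eraseIdx, Finset.sdiff_insert]

variable {F G : List P} {A B : Finset P} {S U W : Finset L} {a : L} {x z : ℕ → P}
  {l : List (Finset P)}

/-- A gradient path between two critical cells as a sequence of moves. -/
theorem IsInitialData.exists_movePath (hlab : IsEdgeLabelling lab)
    (hlci : IsLeastContentIncreasing lab) (hCL : ∀ x : P, x ≠ ⊤ → IsCLLabellingBelow lab x)
    {m : ℕ} {ls rs ws rs' : List L}
    (hx : IsInitialData lab F A (m + 1) ls rs x) (hz : IsInitialData lab G B m ws rs' z)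
    (hws : ws.Pairwise (· > ·)) (hB : IsCritical IsCell (lexMatching lab) B)
    (hl : IsGradientPath (lexMatching lab) A B l) :
    ∃ ops, MovePath lab (m + 1) z x ops ∧ l = trace lab (m + 1) B x ops := by
  have hl' := hl
  rw [← hx.cell] at hl'
  refine hl'.exists_movePath hlab hlci hCL hx.state (hz.isTarget hws) (hx.cell ▸ hx.pivoted) ?_
    (fun C => (hB.2 C).1)
  intro y
  rw [← hz.cell, mem_cellOf]
  exact ⟨fun ⟨i, hi, h⟩ => ⟨i, by omega, h⟩, fun ⟨i, hi, h⟩ => ⟨i, by omega, h⟩⟩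

omit [DecidableEq P] [Finite P] [LinearOrder L] in
theorem eq_of_key_eq (hlab : IsEdgeLabelling lab) {i : ℕ} (h : x i = z i) (hx : x i ⋖ x (i + 1))
    (hz : z i ⋖ z (i + 1)) (hk : key lab (x i) (x (i + 1)) = key lab (z i) (z (i + 1))) :
    x (i + 1) = z (i + 1) := by
  by_contra hne
  rw [← h] at hz hk
  exact hlab.key_ne hx hz hne hk

/-- A gradient path from the cell of `U` to the cell of `W` exists only if `U ⋖ W`. -/
theorem IsInitialData.covBy_of_path (hlab : IsEdgeLabelling lab)
    (hlci : IsLeastContentIncreasing lab) (hCL : ∀ x : P, x ≠ ⊤ → IsCLLabellingBelow lab x)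
    (ha : ∀ b ∈ S, a < b) (hU : U ⊆ S) (hW : W ⊆ S)
    (hx : IsInitialData lab F A (S \ U).card (headLabels S U a) (U.sort (· ≤ ·)) x)
    (hz : IsInitialData lab G B (S \ W).card (headLabels S W a) (W.sort (· ≤ ·)) z)
    (hB : IsCritical IsCell (lexMatching lab) B)
    (hl : IsGradientPath (lexMatching lab) A B l) : U ⋖ W := by
  have hm : (S \ U).card = (S \ W).card + 1 := by
    have := hl.card_eq
    rw [hx.card, hz.card] at this
    omega
  have hcard : W.card = U.card + 1 := by
    have h1 := Finset.card_sdiff_add_card_eq_card hU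
    have h2 := Finset.card_sdiff_add_card_eq_card hW
    omega
  suffices hUW : U ⊆ W by
    refine Finset.covBy_iff_card_sdiff_eq_one.2 ⟨hUW, ?_⟩
    have := Finset.card_sdiff_add_card_eq_card hUW
    omega
  have hget : ∀ k (h : k < (headLabels S W a).length) (h' : k < (headLabels S U a).length)
      (h'' : k + 1 < (headLabels S U a).length) (hk : k < (S \ W).card),
      (headLabels S W a)[k] = ((S \ W).sort (· ≥ ·))[k]'(by rw [Finset.length_sort]; omega) ∧
      (headLabels S U a)[k] = ((S \ U).sort (· ≥ ·))[k]'(by rw [Finset.length_sort]; omega) ∧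
      (headLabels S U a)[k + 1] = ((S \ U).sort (· ≥ ·))[k + 1]'(by rw [Finset.length_sort]; omega) :=
    fun k h h' h'' hk => ⟨headLabels_getElem _ _, headLabels_getElem _ _, headLabels_getElem _ _⟩
  have hpU := headLabels_pairwise U ha
  have hpW := headLabels_pairwise W ha
  have hlastU := headLabels_last S U a
  have hlastW := headLabels_last S W a
  have hlenU := length_headLabels S U a
  have hlenW := length_headLabels S W a
  generalize headLabels S U a = ls at *
  generalize headLabels S W a = ws at *
  rw [hm] at hx
  obtain ⟨ops, hops, -⟩ := hx.exists_movePath hlab hlci hCL hz hpW hB hl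
  have hzt := hz.isTarget hpW
  have hclaim : ∀ k (h : k < ws.length) (h' : k < ls.length), k ∉ ops → ws[k] = ls[k] := by
    intro k h h' hk
    have heq := hops.eq_target_of_notMem hlab hlci hzt hx.state (by omega) hk
    obtain ⟨_, e1⟩ := hx.key_eq k (by omega)
    obtain ⟨_, e2⟩ := hz.key_eq k (by omega)
    rw [heq k (by omega), heq (k + 1) le_rfl, e2] at e1
    exact WithBot.coe_injective e1
  have hmem : (S \ W).card ∈ ops := by
    by_contra h
    have h1 := hclaim _ (by omega) (by omega) h
    rw [hlastW (by omega)] at h1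
    have h2 := List.pairwise_iff_getElem.1 hpU (S \ W).card (S \ U).card (by omega) (by omega)
      (by omega)
    rw [hlastU (by omega), ← h1] at h2
    exact lt_irrefl _ h2
  have hrun := hops.run_last hlab hlci hzt hx.state (hx.covBy _ le_rfl) (by
    obtain ⟨h1, e1⟩ := hx.key_eq _ le_rfl
    obtain ⟨h2, e2⟩ := hz.key_eq _ le_rfl
    have e3 := hlastU (by omega)
    simp only [hm] at e3
    rw [e1, e2, e3, hlastW]) hmem
  obtain ⟨hst, heq⟩ := hops.runMoves_spec hlci hx.state
  have hlt := hst.lt ((S \ W).card + 1) (by omega)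
  rw [heq _ le_rfl, hrun] at hlt
  obtain ⟨d, hd⟩ := hlci.exists_satC hlt.le
  obtain ⟨e, he, hel, -⟩ := hx.rest
  obtain ⟨c, hc, hcl, -⟩ := hd.glue lab he
  refine subset_of_sort_le hU hcard hW (B := (labelSeq lab c).mergeSort (fun x y => decide (x ≤ y)))
    ?_ ?_ ?_ (hz.rest_le hlab hlci hc)
  · intro k hk
    have hk' : k < (S \ W).card := by simpa using hk
    refine ⟨by simp; omega, ?_⟩
    obtain ⟨g1, g2, g3⟩ := hget k (by omega) (by omega) (by omega) hk'
    rw [← g1, ← g2, ← g3]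
    by_cases hko : k ∈ ops
    · left
      have h1 := hops.target_le_succ hlab hlci hzt hx.state (by omega) hko
      obtain ⟨_, e1⟩ := hx.key_eq (k + 1) (by omega)
      obtain ⟨_, e2⟩ := hz.key_eq k (by omega)
      rw [stepKey_of_covBy hlci (hx.covBy (k + 1) (by omega)), e1, e2] at h1
      exact WithBot.coe_le_coe.1 h1
    · exact .inr (hclaim k (by omega) (by omega) hko)
  · have := List.pairwise_mergeSort (le := fun x y : L => decide (x ≤ y))
      (by simpa using fun a b c => le_trans) (by simpa using le_total) (labelSeq lab c)
    simpa using this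
  · intro t ht
    rw [List.mem_mergeSort, hcl, hel]
    simp [ht]

/-- There is at most one gradient path from the cell of `U` to the cell of `insert i U`. -/
theorem IsInitialData.path_unique (hlab : IsEdgeLabelling lab)
    (hlci : IsLeastContentIncreasing lab) (hCL : ∀ x : P, x ≠ ⊤ → IsCLLabellingBelow lab x)
    (ha : ∀ b ∈ S, a < b) {i : L} (hi : i ∈ S \ U)
    {rs rs' : List L} (hx : IsInitialData lab F A (S \ U).card (headLabels S U a) rs x)
    (hz : IsInitialData lab G B (S \ insert i U).card (headLabels S (insert i U) a) rs' z)
    (hB : IsCritical IsCell (lexMatching lab) B) {l' : List (Finset P)}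
    (hl : IsGradientPath (lexMatching lab) A B l) (hl' : IsGradientPath (lexMatching lab) A B l') :
    l = l' := by
  have hm : (S \ U).card = (S \ insert i U).card + 1 := by
    rw [Finset.sdiff_insert, Finset.card_erase_add_one hi]
  have hpU := headLabels_pairwise U ha
  have hpW := headLabels_pairwise (insert i U) ha
  obtain ⟨j, hj, hjW⟩ := headLabels_insert (a := a) hi
  have hlenU := length_headLabels S U a
  rw [hm] at hx
  rw [hjW] at hz hpW
  generalize headLabels S U a = ls at *
  have hzt := hz.isTarget hpW
  have hlow : ∀ k < j, key lab (z k) (z (k + 1)) = key lab (x k) (x (k + 1)) := by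
    intro k hk
    obtain ⟨h1, e1⟩ := hz.key_eq k (by omega)
    obtain ⟨h2, e2⟩ := hx.key_eq k (by omega)
    rw [e1, e2, List.getElem_eraseIdx_of_lt _ hk]
  have hhigh : ∀ k, j ≤ k → k < (S \ insert i U).card + 1 →
      key lab (z k) (z (k + 1)) = key lab (x (k + 1)) (x (k + 2)) := by
    intro k hk hkm
    obtain ⟨h1, e1⟩ := hz.key_eq k (by omega)
    obtain ⟨h2, e2⟩ := hx.key_eq (k + 1) (by omega)
    rw [e1, e2, List.getElem_eraseIdx_of_ge _ hk]
  have hpre : ∀ k ≤ j, x k = z k := by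
    intro k hk
    induction k with
    | zero => rw [hx.state.bot, hz.state.bot]
    | succ k ih =>
      exact eq_of_key_eq hlab (ih (by omega)) (hx.covBy k (by omega)) (hz.covBy k (by omega))
        (hlow k hk).symm
  have hops : ∀ {l : List (Finset P)}, IsGradientPath (lexMatching lab) A B l →
      l = trace lab ((S \ insert i U).card + 1) B x
        (List.range' j ((S \ insert i U).card + 1 - j)) := by
    intro l hl
    obtain ⟨ops, hops, rfl⟩ := hx.exists_movePath hlab hlci hCL hz hpW hB hl
    rw [hops.eq_range hlab hlci hzt hx.state hx.covBy (by omega) hhigh hpre (fun _ _ _ => rfl) ?_]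
    intro hlt heq
    obtain ⟨h1, e1⟩ := hx.key_eq j (by omega)
    obtain ⟨h2, e2⟩ := hx.key_eq (j + 1) (by omega)
    have h3 := hhigh j le_rfl hlt
    rw [← hpre j le_rfl, ← heq, e1, e2] at h3
    have h4 := List.pairwise_iff_getElem.1 hpU j (j + 1) h1 h2 (Nat.lt_succ_self j)
    exact h4.ne (WithBot.coe_injective h3).symm
  rw [hops hl, hops hl']

omit [Finite P] in
/-- If all covering relations are labelled, then a critical cell of `F` has fewer elements than
`F` has labels. -/
theorem Contributes.card_lt (hlab : IsEdgeLabelling lab)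
    (htop : ∀ x : P, x ⋖ ⊤ → (lab x ⊤).isSome) (hA : Contributes lab F A)
    (hpos : 0 < (labelSeq lab F).length) : A.card < (labelSeq lab F).length := by
  have hF := isSatChain_iff.1 hA.1.1
  obtain ⟨x, e, hx0, hx, hxF, he, hel, heF, hcov⟩ := hF.exists_prefix hlab le_rfl
  have hxt : x (labelSeq lab F).length = ⊤ := by
    by_contra hne
    obtain ⟨y, d, rfl, hy, hd⟩ := he.exists_cons hne
    have : ∃ b, lab (x (labelSeq lab F).length) y = some b := by
      by_cases h : y = ⊤
      · exact Option.isSome_iff_exists.1 (h ▸ htop _ (h ▸ hy))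
      · exact hlab.exists_label hy h
    obtain ⟨b, hb⟩ := this
    rw [hd.labelSeq_cons, hb] at hel
    simp at hel
  have hsub : A ⊆ (Finset.Ico 1 (labelSeq lab F).length).image x := by
    intro t ht
    have ht := mem_facet.1 (hA.1.2.1 ht)
    rcases hcov t ht.1 with ⟨i, hi, rfl⟩ | hte
    · refine Finset.mem_image_of_mem x (Finset.mem_Ico.2 ⟨?_, hi⟩)
      rcases Nat.eq_zero_or_pos i with rfl | h
      · exact absurd hx0 ht.2.1
      · exact h
    · exact absurd (top_le_iff.1 (hxt ▸ (he.mem_bounds hte).1)) ht.2.2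
  have := (Finset.card_le_card hsub).trans Finset.card_image_le
  rw [Nat.card_Ico] at this
  omega

end Edges

end LexMorse

theorem mainTheorem10 {P : Type*} [PartialOrder P] [BoundedOrder P] [Finite P] [DecidableEq P]
    {L : Type*} [LinearOrder L] (lab : P → P → Option L)
    (hlab : LexMorse.IsEdgeLabelling lab)
    (hlci : LexMorse.IsLeastContentIncreasing lab)
    (hCL : ∀ x : P, x ≠ ⊤ → LexMorse.IsCLLabellingBelow lab x)
    (N : List P) (hN : LexMorse.IsSatChain ⊥ ⊤ N)
    (hNcrit : ∃ A, LexMorse.Contributes lab N A)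
    (a : L) (ha : IsLeast {x | x ∈ LexMorse.labelSeq lab N} a)
    (S : Finset L) (hS : S = (LexMorse.labelSeq lab N).toFinset.erase a)
    (T : Finset L) (hT : T ⊆ S)
    (F : Finset L → List P) (Crit : Finset L → Finset P)
    (hF : ∀ U ⊆ T, LexMorse.IsSatChain ⊥ ⊤ (F U) ∧
      LexMorse.labelSeq lab (F U) = (S \ U).sort (· ≥ ·) ++ a :: U.sort (· ≤ ·))
    (hCrit : ∀ U ⊆ T, LexMorse.Contributes lab (F U) (Crit U))
    (hpath : ∀ U ⊆ T, ∀ i ∈ T \ U,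
      ∃ l, LexMorse.IsGradientPath (LexMorse.lexMatching lab) (Crit U) (Crit (insert i U)) l) :
    LexMorse.SitsAsBooleanAlgebra LexMorse.IsCell (LexMorse.lexMatching lab) T Crit := by
  have haS : ∀ b ∈ S, a < b := by
    intro b hb
    rw [hS, Finset.mem_erase, List.mem_toFinset] at hb
    exact (ha.2 hb.2).lt_of_ne hb.1.symm
  have hseq : ∀ U ⊆ T, LexMorse.labelSeq lab (F U) =
      LexMorse.headLabels S U a ++ U.sort (· ≤ ·) := fun U hU => by
    rw [(hF U hU).2, LexMorse.headLabels, List.append_assoc]; rfl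
  have hdata : ∀ U ⊆ T, ((∀ x : P, x ⋖ ⊤ → lab x ⊤ = none) ∨ U.sort (· ≤ ·) ≠ []) →
      ∃ x, LexMorse.IsInitialData lab (F U) (Crit U) (S \ U).card (LexMorse.headLabels S U a)
        (U.sort (· ≤ ·)) x := by
    intro U hU htop
    refine (hCrit U hU).exists_initialData hlab hlci hCL htop (LexMorse.length_headLabels S U a)
      (LexMorse.headLabels_pairwise U haS) (hseq U hU) fun h b hb => ?_
    rw [LexMorse.headLabels_last]
    exact (haS b (hT (hU (by simpa using hb)))).le
  have htop : T.Nonempty → ∀ x : P, x ⋖ ⊤ → lab x ⊤ = none := by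
    rintro ⟨i, hi⟩
    refine hlab.2.1.resolve_left fun hall => ?_
    obtain ⟨l, hl⟩ := hpath ∅ (Finset.empty_subset _) i (by simpa using hi)
    have hiT : insert i ∅ ⊆ T := by simpa using hi
    obtain ⟨x, hx⟩ := hdata (insert i ∅) hiT (.inr (by simp))
    have h1 := hl.card_eq
    have h2 := (hCrit ∅ (Finset.empty_subset _)).card_lt hlab hall (by
      rw [hseq ∅ (Finset.empty_subset _)]; simp [LexMorse.headLabels])
    rw [hseq ∅ (Finset.empty_subset _)] at h2
    have h3 := Finset.card_sdiff_add_card_eq_card (hiT.trans hT)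
    rw [hx.card] at h1
    simp [LexMorse.headLabels] at h1 h2 h3
    omega
  refine ⟨fun U hU => (hCrit U hU).2, ?_, ?_, ?_⟩
  · intro U hU W hW heq
    have hUn := (hCrit U hU).1
    have hWn := (hCrit W hW).1
    have hlab_eq : LexMorse.labelSeq lab (F U) = LexMorse.labelSeq lab (F W) := by
      rcases lt_trichotomy (LexMorse.labelSeq lab (F U)) (LexMorse.labelSeq lab (F W)) with h | h | h
      · exact absurd (heq ▸ hUn.2.1) (hWn.2.2 _ hUn.1 h)
      · exact h
      · exact absurd (heq ▸ hWn.2.1) (hUn.2.2 _ hWn.1 h)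
    have hnot : ∀ V : Finset L, a ∉ (S \ V).sort (· ≥ ·) := fun V h => by
      simp only [Finset.mem_sort, Finset.mem_sdiff] at h
      exact lt_irrefl _ (haS a h.1)
    have hnot' : ∀ V ⊆ T, a ∉ V.sort (· ≤ ·) := fun V hV h => by
      rw [Finset.mem_sort] at h
      exact lt_irrefl _ (haS a (hT (hV h)))
    rw [(hF U hU).2, (hF W hW).2] at hlab_eq
    have := (List.append_cons_inj_of_notMem (hnot U) (hnot' U hU)).1 hlab_eq
    have := congrArg List.toFinset this.2.2
    simpa using this
  · intro U hU W hW hUW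
    obtain ⟨i, hiU, rfl⟩ := Finset.covBy_iff_exists_insert.1 hUW
    have hiT : i ∈ T := hW (Finset.mem_insert_self _ _)
    have htop := htop ⟨i, hiT⟩
    obtain ⟨l, hl⟩ := hpath U hU i (Finset.mem_sdiff.2 ⟨hiT, hiU⟩)
    obtain ⟨x, hx⟩ := hdata U hU (.inl htop)
    obtain ⟨z, hz⟩ := hdata _ hW (.inl htop)
    refine ⟨l, ⟨(hCrit U hU).2, (hCrit _ hW).2, hl⟩, fun l' hl' => ?_⟩
    exact hx.path_unique hlab hlci hCL haS (Finset.mem_sdiff.2 ⟨hT hiT, hiU⟩) hz (hCrit _ hW).2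
      hl'.2.2 hl
  · rintro U hU W hW hUW ⟨l, -, -, hl⟩
    rcases T.eq_empty_or_nonempty with rfl | hne
    · rw [Finset.subset_empty.1 hU, Finset.subset_empty.1 hW] at hl
      have := hl.card_eq
      omega
    · obtain ⟨x, hx⟩ := hdata U hU (.inl (htop hne))
      obtain ⟨z, hz⟩ := hdata W hW (.inl (htop hne))
      exact hUW (hx.covBy_of_path hlab hlci hCL haS (hU.trans hT) (hW.trans hT) hz (hCrit W hW).2 hl)
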